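/- Let $n\ge 1$ and let $e_i,f_i,h_i$ ($i=1,\dots,n$) be the Chevalley generators of $\mathfrak{sl}(n+1)$ over $\mathbb C$. For a module with highest weight vector $v$, the Shapovalov form is the symmetric bilinear form $B$ with $B(e_ix,y)=B(x,f_iy)$ and $B(v,v)=1$; on a tensor product one takes the tensor product of the Shapovalov forms of the factors. Let $\lambda=(\lambda_1,\dots,\lambda_n)\in\mathbb C^n$, let $V_\lambda$ be the Verma module with highest weight vector $v_\lambda$ satisfying $h_iv_\lambda=\lambda_iv_\lambda$, and let $V_\omega=\mathbb C^{n+1}$ be the linear representation with highest weight vector $v_0$. For $\kappa\in\mathbb C\setminus\{0\}$ consider the multivalued function $$\Phi_n(\lambda,\kappa)(t)=\prod_{j=1}^n t_j^{-\lambda_j/\kappa}\;(1-t_1)^{-1/\kappa}\prod_{j=2}^n(t_j-t_{j-1})^{-1/\kappa}$$ on the set of those $t\in\mathbb C^n$ for which no factor vanishes. For a word $I=(i_1,\dots,i_m)$ in $\{1,\dots,n\}$ write $f^Iv=f_{i_1}\cdots f_{i_m}v$ and $$\omega_{I,J}(t)=c_{I,0}(t)\,c_{J,1}(t),\qquad c_{I,z}(t)=\frac{1}{(t_{i_1}-t_{i_2})(t_{i_2}-t_{i_3})\cdots(t_{i_{m-1}}-t_{i_m})(t_{i_m}-z)},\quad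 c_{\emptyset,z}=1 .$$ Suppose that $\lambda_k+\dots+\lambda_n+n-k\ne 0$ and $\lambda_k+\dots+\lambda_n+n-k+1\neq 0$ for $k=1,\dots,n$. Then $\Phi_n(\lambda,\kappa)$ has exactly one critical point $t^n=(t^n_1,\dots,t^n_n)$. Suppose moreover that the coordinates of $t^n$ are pairwise distinct. Let $$X^n(\lambda)=\sum_{(I,J)}\omega_{I,J}(t^n)\,f^Iv_\lambda\otimes f^Jv_0\in V_\lambda\otimes V_\omega$$ be the Bethe vector, where the sum is over all pairs of words $(I,J)$ which together contain each of $1,\dots,n$ exactly once (terms with $f^Jv_0=0$ are omitted), and write $X^n(\lambda)=x^n_n\otimes v_0+x^n_{n-1}\otimes f_1v_0+\dots+x^n_0\otimes f_n\cdots f_1v_0$ with $x_i^n\in V_\lambda$. Then $$B(X^n(\lambda),X^n(\lambda))=\prod_{k=1}^n\frac{(\lambda_k+\dots+\lambda_n+n-k+1)^{2(n-k)+3}}{(\lambda_k+\dots+\lambda_n+n-k)^{2(n-k)+1}}$$ and $$B(x^n_n,x^n_n)=\frac{B(X^n(\lambda),X^n(\lambda))}{\lambda_1+\dots+\lambda_n+n}.$$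 -/

import Mathlib

open scoped TensorProduct

noncomputable section

namespace BetheNorm

attribute [local instance 100] LieRing.ofAssociativeRing

/-! ### The Lie algebra `sl(n+1)` and its Chevalley generators

The simple roots are indexed by `Fin n`, so the index `i : Fin n` stands for the `(i+1)`-st root. -/

/-- The Lie algebra `sl(n+1)` over `ℂ`: traceless complex matrices of size `n+1`. -/
abbrev Sl (n : ℕ) := LieAlgebra.SpecialLinear.sl (Fin (n + 1)) ℂ

/-- `e_i = E_{i,i+1}`. -/
def chevE {n : ℕ} (i : Fin n) : Sl n :=
  LieAlgebra.SpecialLinear.single i.castSucc i.succ (Fin.castSucc_lt_succ (i := i)).ne 1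

/-- `f_i = E_{i+1,i}`. -/
def chevF {n : ℕ} (i : Fin n) : Sl n :=
  LieAlgebra.SpecialLinear.single i.succ i.castSucc (Fin.castSucc_lt_succ (i := i)).ne' 1

/-- `h_i = E_{i,i} - E_{i+1,i+1}`. -/
def chevH {n : ℕ} (i : Fin n) : Sl n :=
  LieAlgebra.SpecialLinear.singleSubSingle i.castSucc i.succ 1

/-- `f^I v = f_{i_1} f_{i_2} ⋯ f_{i_m} v` for the word `I = [i_1, …, i_m]`. -/
def fWord {n : ℕ} {V : Type*} [AddCommGroup V] [LieRingModule (Sl n) V]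
    (I : List (Fin n)) (v : V) : V :=
  I.foldr (fun i x => ⁅chevF i, x⁆) v

/-! ### The Shapovalov form -/

/-- `B` is a symmetric bilinear form with `B(e_i x, y) = B(x, f_i y)` and `B(v, v) = 1`. -/
structure IsShapovalovForm (n : ℕ) {V : Type*} [AddCommGroup V] [Module ℂ V]
    [LieRingModule (Sl n) V] (v : V) (B : LinearMap.BilinForm ℂ V) : Prop where
  symm : ∀ x y, B x y = B y x
  contravariant : ∀ (i : Fin n) (x y : V), B ⁅chevE i, x⁆ y = B x ⁅chevF i, y⁆
  normalized : B v v = 1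

open Classical in
/-- The Shapovalov form of an `sl(n+1)`-module with highest weight vector `v`: the form that
satisfies `IsShapovalovForm n v`. (On a module generated by `v` there is at most one such form; the
value `0` is a placeholder for modules without such a form.) -/
def shapovalovForm (n : ℕ) {V : Type*} [AddCommGroup V] [Module ℂ V]
    [LieRingModule (Sl n) V] (v : V) : LinearMap.BilinForm ℂ V :=
  if h : ∃ B : LinearMap.BilinForm ℂ V, IsShapovalovForm n v B then h.choose else 0

/-! ### The Verma module -/

/-- The universal enveloping algebra `U(sl(n+1))`. -/
abbrev USl (n : ℕ) := UniversalEnvelopingAlgebra ℂ (Sl n)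

/-- The left ideal of `U(sl(n+1))` generated by the `e_i` and the `h_i - λ_i`. -/
def vermaIdeal {n : ℕ} (lam : Fin n → ℂ) : Submodule (USl n) (USl n) :=
  Submodule.span (USl n)
    (Set.range (fun i => UniversalEnvelopingAlgebra.ι ℂ (chevE i)) ∪
      Set.range (fun i => UniversalEnvelopingAlgebra.ι ℂ (chevH i) -
        algebraMap ℂ (USl n) (lam i)))

/-- The Verma module `V_λ` with highest weight `λ`, where `λ_i = (λ, α_i) = λ(h_i)`. -/
def Verma {n : ℕ} (lam : Fin n → ℂ) : Type := USl n ⧸ vermaIdeal lam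

instance {n : ℕ} (lam : Fin n → ℂ) : AddCommGroup (Verma lam) :=
  inferInstanceAs (AddCommGroup (USl n ⧸ vermaIdeal lam))

instance {n : ℕ} (lam : Fin n → ℂ) : Module (USl n) (Verma lam) :=
  inferInstanceAs (Module (USl n) (USl n ⧸ vermaIdeal lam))

instance {n : ℕ} (lam : Fin n → ℂ) : Module ℂ (Verma lam) :=
  inferInstanceAs (Module ℂ (USl n ⧸ vermaIdeal lam))

instance {n : ℕ} (lam : Fin n → ℂ) : IsScalarTower ℂ (USl n) (Verma lam) :=
  inferInstanceAs (IsScalarTower ℂ (USl n) (USl n ⧸ vermaIdeal lam))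

/-- `sl(n+1)` acts on the Verma module through its enveloping algebra. -/
instance {n : ℕ} (lam : Fin n → ℂ) : LieRingModule (Sl n) (Verma lam) where
  bracket x m := UniversalEnvelopingAlgebra.ι ℂ x • m
  add_lie x y m := by
    change UniversalEnvelopingAlgebra.ι ℂ (x + y) • m = _
    rw [map_add, add_smul]
  lie_add x m m' := smul_add _ m m'
  leibniz_lie x y m := by
    change UniversalEnvelopingAlgebra.ι ℂ x • UniversalEnvelopingAlgebra.ι ℂ y • m =
      UniversalEnvelopingAlgebra.ι ℂ ⁅x, y⁆ • m +
        UniversalEnvelopingAlgebra.ι ℂ y • UniversalEnvelopingAlgebra.ι ℂ x • m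
    rw [LieHom.map_lie, LieRing.of_associative_ring_bracket, sub_smul, mul_smul, mul_smul]
    abel

instance {n : ℕ} (lam : Fin n → ℂ) : LieModule ℂ (Sl n) (Verma lam) where
  smul_lie c x m := by
    change UniversalEnvelopingAlgebra.ι ℂ (c • x) • m = c • UniversalEnvelopingAlgebra.ι ℂ x • m
    rw [map_smul, smul_assoc]
  lie_smul c x m := by
    change UniversalEnvelopingAlgebra.ι ℂ x • c • m = c • UniversalEnvelopingAlgebra.ι ℂ x • m
    rw [← algebraMap_smul (USl n) c m, ← algebraMap_smul (USl n) c
      (UniversalEnvelopingAlgebra.ι ℂ x • m), ← mul_smul, ← mul_smul, Algebra.commutes]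

/-- The highest weight vector `v_λ` of the Verma module. -/
def vermaVec {n : ℕ} (lam : Fin n → ℂ) : Verma lam :=
  (Submodule.Quotient.mk 1 : USl n ⧸ vermaIdeal lam)

/-! ### The linear representation -/

/-- The linear representation `V_ω = ℂ^{n+1}`; a matrix acts by multiplication on a vector. -/
abbrev LinRep (n : ℕ) := Fin (n + 1) → ℂ

/-- The highest weight vector `v_0` of `V_ω`, the first standard basis vector. -/
def linVec (n : ℕ) : LinRep n := Pi.single 0 1

/-- The Shapovalov form of `V_λ ⊗ V_ω`: the tensor product of the Shapovalov forms. -/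
def tensorForm {n : ℕ} (lam : Fin n → ℂ) : LinearMap.BilinForm ℂ (Verma lam ⊗[ℂ] LinRep n) :=
  (shapovalovForm n (vermaVec lam)).tmul (shapovalovForm n (linVec n))

/-! ### The phase function and its critical points -/

/-- The linear functions `1 - t_1` (for `j = 1`) and `t_j - t_{j-1}` (for `j ≥ 2`). -/
def linkForm {n : ℕ} (t : Fin n → ℂ) (j : Fin n) : ℂ :=
  if (j : ℕ) = 0 then 1 - t j
  else t j - t ⟨(j : ℕ) - 1, lt_of_le_of_lt (Nat.sub_le _ _) j.isLt⟩

/-- A branch, near a point `t` at which no factor vanishes, of the multivalued phase function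
`Φ_n(λ, κ)(s) = ∏_j s_j^{-λ_j/κ} · (1 - s_1)^{-1/κ} · ∏_{j ≥ 2} (s_j - s_{j-1})^{-1/κ}`.
The branch of `ℓ(s)^c` near `t` is `ℓ(t)^c (ℓ(s)/ℓ(t))^c`, with principal powers: it is analytic
at `s = t`, and any other branch of `Φ_n(λ, κ)` near `t` is a nonzero constant multiple. -/
def phaseBranch {n : ℕ} (lam : Fin n → ℂ) (κ : ℂ) (t s : Fin n → ℂ) : ℂ :=
  ∏ j, (t j ^ (-lam j / κ) * (s j / t j) ^ (-lam j / κ)) *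
    (linkForm t j ^ (-1 / κ) * (linkForm s j / linkForm t j) ^ (-1 / κ))

/-- `t` is a critical point of `Φ_n(λ, κ)`: it lies in the domain of this multivalued function
(no factor vanishes at `t`), and the differential `dΦ_n(λ, κ)` vanishes at `t`. -/
structure IsCriticalPoint {n : ℕ} (lam : Fin n → ℂ) (κ : ℂ) (t : Fin n → ℂ) : Prop where
  coord_ne_zero : ∀ j, t j ≠ 0
  link_ne_zero : ∀ j, linkForm t j ≠ 0
  hasFDerivAt_zero : HasFDerivAt (phaseBranch lam κ t) (0 : (Fin n → ℂ) →L[ℂ] ℂ) t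

/-! ### The Bethe vector -/

/-- `1 / ((t_{i_1} - t_{i_2}) (t_{i_2} - t_{i_3}) ⋯ (t_{i_{m-1}} - t_{i_m}) (t_{i_m} - z))` for the
word `[i_1, …, i_m]`, and `1` for the empty word. -/
def chainFun {n : ℕ} (t : Fin n → ℂ) (z : ℂ) : List (Fin n) → ℂ
  | [] => 1
  | [i] => (t i - z)⁻¹
  | i :: j :: I => (t i - t j)⁻¹ * chainFun t z (j :: I)

/-- The rational function `ω_{I,J}` at `z_1 = 0`, `z_2 = 1`. -/
def omegaFun {n : ℕ} (I J : List (Fin n)) (t : Fin n → ℂ) : ℂ :=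
  chainFun t 0 I * chainFun t 1 J

/-- `∑ ω_{I,J}(t) f^I v_λ ⊗ f^J v_0`, the sum over all pairs of words `(I, J)` which together
contain each index exactly once. Such a pair is the same as an ordering `σ` of all the indices
together with the length `m ≤ n` of `I`: the word `I` consists of the first `m` terms of the
ordering, and `J` of the remaining ones. At the critical point this is the Bethe vector
`X^n(λ)`. -/
def betheVector {n : ℕ} (lam : Fin n → ℂ) (t : Fin n → ℂ) : Verma lam ⊗[ℂ] LinRep n :=
  ∑ σ : Equiv.Perm (Fin n), ∑ m ∈ Finset.range (n + 1),
    omegaFun ((List.ofFn σ).take m) ((List.ofFn σ).drop m) t •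
      (fWord ((List.ofFn σ).take m) (vermaVec lam) ⊗ₜ[ℂ]
        fWord ((List.ofFn σ).drop m) (linVec n))

/-- The component `x_n^n ∈ V_λ` of the Bethe vector at `v_0`, in its expansion along the basis
`v_0, f_1 v_0, f_2 f_1 v_0, …` (the standard basis) of `V_ω`. -/
def betheTop {n : ℕ} (lam : Fin n → ℂ) (t : Fin n → ℂ) : Verma lam :=
  TensorProduct.rid ℂ (Verma lam)
    (LinearMap.lTensor (Verma lam) (LinearMap.proj (0 : Fin (n + 1)) : LinRep n →ₗ[ℂ] ℂ)
      (betheVector lam t))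

/-- With `k` counted from `1`, the number `A_k = λ_k + ⋯ + λ_n + n - k`. -/
def tailSum {n : ℕ} (lam : Fin n → ℂ) (k : Fin n) : ℂ :=
  ∑ i ∈ Finset.Ici k, lam i + ((n - (k + 1) : ℕ) : ℂ)

end BetheNorm

end

open scoped TensorProduct

noncomputable section

namespace BetheNorm

attribute [local instance 100] LieRing.ofAssociativeRing

/-! ### Strictly upper triangular parts -/

section Upper

variable {m : ℕ} {R : Type*} [CommRing R]

/-! Number the letters from 0. Put `T_0 = 1`, let `T_1, …, T_n` be the coordinates of `t`
(`extCoord`), `d_k = T_{k+1} - T_k` (`coordStep`) and `A_k = tailSum lam k`.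

Critical points. The logarithmic derivative of the phase gives one equation per letter, with `κ`
only a common factor (`isCriticalPoint_iff`). Solved from the last letter backwards, these equations
become `T_{k+1} (A_k + 1) = A_k T_k` (`betheEq_iff`), so `T_k` is the product of the ratios `A_j /
(A_j + 1)` over `j < k`, and existence and uniqueness follow.

Norm. The only word of length `k` not killing `v_0` is `k-1, …, 1, 0`, so the Bethe vector is a sum
over `k` of `c_k w_k ⊗ E_k`, where `E_k` is the standard basis and `w_k` is the sum of `c_{I,0}(t)
f^I v_λ` over all orderings `I` of the letters from `k` on (`betheVector_eq`). Partial fractions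
show that `e_i` removes the letter `i` from such a sum and multiplies it by a truncated left-hand
side of the `i`-th Bethe equation (`chevE_wordSum_cons`). At the critical point this factor vanishes
unless `i = k`, and `e_k w_k = -d_k⁻¹ w_{k+1}`. Hence contravariance kills `B(f^I v_λ, w_k)` except
for the increasing word `I`, and `B(w_k, w_k)` is a product (`shapovalovForm_wordSum_self`). With `P
= ∏ d_j⁻¹`, the `k`-th summand of the norm is `-d_k P² / T_n` for `k < n` and `P²` for `k = n`;
these telescope to `P² / T_n` (`tensorForm_betheVector_eq`), and the first summand has ratio `-d_0 =
1 / (A_0 + 1)` to the total. Substituting the solution for `T` gives the stated product.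

Existence of the form. The form on the Verma module comes from a functional `φ` with `φ(v_λ) = 1`
that kills the images of the `f_i`. It is found by mapping the Verma module to polynomials on the
open cell of the flag variety, twisted by `λ`, and evaluating at the base point
(`exists_vermaCoeff`). -/

/-- The strictly upper triangular part of a matrix. -/
def upperPart (a : Matrix (Fin m) (Fin m) R) : Matrix (Fin m) (Fin m) R :=
  Matrix.of fun i j => if i < j then a i j else 0

lemma upperPart_apply (a : Matrix (Fin m) (Fin m) R) (i j : Fin m) :
    upperPart a i j = if i < j then a i j else 0 := rfl

lemma upperPart_add (a b : Matrix (Fin m) (Fin m) R) :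
    upperPart (a + b) = upperPart a + upperPart b := by
  ext i j; simp only [upperPart_apply, Matrix.add_apply]; split_ifs <;> simp

lemma upperPart_smul {S : Type*} [SMulZeroClass S R] (c : S) (a : Matrix (Fin m) (Fin m) R) :
    upperPart (c • a) = c • upperPart a := by
  ext i j; simp only [upperPart_apply, Matrix.smul_apply]; split_ifs <;> simp

lemma upperPart_mul_upperPart_apply (a b : Matrix (Fin m) (Fin m) R) {i j : Fin m} (h : j ≤ i) :
    (upperPart a * upperPart b) i j = 0 := by
  rw [Matrix.mul_apply]
  refine Finset.sum_eq_zero fun k _ => ?_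
  simp only [upperPart_apply]
  split_ifs with h1 h2 <;> first | (exfalso; omega) | simp

lemma lowerPart_mul_lowerPart_apply (a b : Matrix (Fin m) (Fin m) R) {i j : Fin m} (h : i < j) :
    ((a - upperPart a) * (b - upperPart b)) i j = 0 := by
  rw [Matrix.mul_apply]
  refine Finset.sum_eq_zero fun k _ => ?_
  simp only [Matrix.sub_apply, upperPart_apply]
  split_ifs with h1 h2 <;> first | (exfalso; omega) | simp

lemma lowerPart_mul_lowerPart_diag (a b : Matrix (Fin m) (Fin m) R) (i : Fin m) :
    ((a - upperPart a) * (b - upperPart b)) i i = a i i * b i i := by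
  rw [Matrix.mul_apply, Finset.sum_eq_single i]
  · simp [upperPart_apply]
  · intro k _ hk
    simp only [Matrix.sub_apply, upperPart_apply]
    split_ifs with h1 h2 <;> first | (exfalso; omega) | simp
  · simp

lemma commutator_decomp (a b : Matrix (Fin m) (Fin m) R) :
    a * b - b * a = (upperPart a * b - b * upperPart a) + (a * upperPart b - upperPart b * a)
      - (upperPart a * upperPart b - upperPart b * upperPart a)
      + ((a - upperPart a) * (b - upperPart b) - (b - upperPart b) * (a - upperPart a)) := by
  noncomm_ring

/-- The two remainders `a - upperPart a` and `b - upperPart b` are lower triangular, so their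
commutator has no strictly upper part and drops out of `commutator_decomp`. This is what makes
`cellField` a Lie homomorphism. -/
lemma upperPart_commutator (a b : Matrix (Fin m) (Fin m) R) :
    upperPart (a * b - b * a) =
      upperPart (upperPart a * b - b * upperPart a) - upperPart (upperPart b * a - a * upperPart b)
      - (upperPart a * upperPart b - upperPart b * upperPart a) := by
  ext i j
  by_cases h : i < j
  · have := congrFun (congrFun (commutator_decomp a b) i) j
    simp only [Matrix.add_apply, Matrix.sub_apply (_ * _ : Matrix (Fin m) (Fin m) R),
      lowerPart_mul_lowerPart_apply _ _ h] at this
    simp only [Matrix.sub_apply (upperPart _), upperPart_apply _ i j, if_pos h, Matrix.sub_apply]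
    simp only [Matrix.sub_apply] at this
    rw [this]; simp only [Matrix.add_apply, Matrix.sub_apply]; ring
  · have h' := not_lt.1 h
    simp only [Matrix.sub_apply, upperPart_apply _ i j, if_neg h,
      upperPart_mul_upperPart_apply _ _ h']
    simp

/-- Products of strictly upper parts have zero diagonal, and the diagonals of the lower triangular
remainders multiply as scalars, so both commutators vanish there. This is the cocycle condition for
the twist by a weight. -/
lemma diag_commutator (a b : Matrix (Fin m) (Fin m) R) (i : Fin m) :
    (a * b - b * a) i i = (upperPart a * b - b * upperPart a) i i
      - (upperPart b * a - a * upperPart b) i i := by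
  have := congrFun (congrFun (commutator_decomp a b) i) i
  have e1 := upperPart_mul_upperPart_apply a b (le_refl i)
  have e2 := upperPart_mul_upperPart_apply b a (le_refl i)
  have e3 := lowerPart_mul_lowerPart_diag a b i
  have e4 := lowerPart_mul_lowerPart_diag b a i
  rw [this, Matrix.add_apply, Matrix.sub_apply, Matrix.add_apply,
    Matrix.sub_apply (upperPart a * upperPart b), Matrix.sub_apply ((a - _) * _), e1, e2, e3, e4]
  simp only [Matrix.sub_apply]
  ring

lemma map_derivation_mul {A : Type*} [CommRing A] [Algebra A R] (D : Derivation A R R)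
    (a b : Matrix (Fin m) (Fin m) R) : (a * b).map D = a.map D * b + a * b.map D := by
  ext i j
  simp only [Matrix.map_apply, Matrix.mul_apply, Matrix.add_apply, map_sum, Derivation.leibniz,
    smul_eq_mul, ← Finset.sum_add_distrib]
  refine Finset.sum_congr rfl fun k _ => by ring

end Upper

/-! ### The action of `sl(n+1)` by differential operators on the open cell -/

section OpenCell

variable {n : ℕ}

/-- Polynomial functions in the entries of a matrix of size `n+1`. -/
abbrev CellRing (n : ℕ) := MvPolynomial (Fin (n + 1) × Fin (n + 1)) ℂ

/-- The generic unipotent upper triangular matrix. -/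
def genericUnipotent (n : ℕ) : Matrix (Fin (n + 1)) (Fin (n + 1)) (CellRing n) :=
  upperPart (Matrix.of fun i j => MvPolynomial.X (i, j)) + 1

lemma det_genericUnipotent : (genericUnipotent n).det = 1 := by
  rw [Matrix.det_of_isUpperTriangular]
  · simp [genericUnipotent, upperPart_apply]
  · intro i j hij
    have hij : j < i := hij
    simp [genericUnipotent, upperPart_apply, hij.not_gt, Matrix.one_apply_ne hij.ne']

lemma genericUnipotent_mul_inv : genericUnipotent n * (genericUnipotent n)⁻¹ = 1 :=
  Matrix.mul_nonsing_inv _ (by simp [det_genericUnipotent])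

lemma genericUnipotent_inv_mul : (genericUnipotent n)⁻¹ * genericUnipotent n = 1 :=
  Matrix.nonsing_inv_mul _ (by simp [det_genericUnipotent])

/-- The conjugate of a constant matrix by the generic unipotent matrix. -/
def cellConj : Matrix (Fin (n + 1)) (Fin (n + 1)) ℂ →ₗ[ℂ]
    Matrix (Fin (n + 1)) (Fin (n + 1)) (CellRing n) where
  toFun x := genericUnipotent n * x.map MvPolynomial.C * (genericUnipotent n)⁻¹
  map_add' x y := by
    rw [Matrix.map_add _ (map_add _), mul_add, add_mul]
  map_smul' c x := by
    have : (c • x).map (MvPolynomial.C : ℂ →+* CellRing n) = c • x.map MvPolynomial.C := by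
      ext1 i j; simp [MvPolynomial.smul_eq_C_mul]
    rw [this]; simp

lemma cellConj_apply (x : Matrix (Fin (n + 1)) (Fin (n + 1)) ℂ) :
    cellConj x = genericUnipotent n * x.map MvPolynomial.C * (genericUnipotent n)⁻¹ := rfl

lemma cellConj_commutator (x y : Matrix (Fin (n + 1)) (Fin (n + 1)) ℂ) :
    cellConj (x * y - y * x) = cellConj x * cellConj y - cellConj y * cellConj x := by
  have h : ∀ x y : Matrix (Fin (n + 1)) (Fin (n + 1)) ℂ,
      cellConj (x * y) = cellConj x * cellConj y := by
    intro x y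
    simp only [cellConj_apply, Matrix.map_mul]
    have : genericUnipotent n * x.map MvPolynomial.C * (genericUnipotent n)⁻¹ *
        (genericUnipotent n * y.map MvPolynomial.C * (genericUnipotent n)⁻¹) =
        genericUnipotent n * x.map MvPolynomial.C * ((genericUnipotent n)⁻¹ * genericUnipotent n) *
          y.map MvPolynomial.C * (genericUnipotent n)⁻¹ := by
      simp only [mul_assoc]
    rw [this, genericUnipotent_inv_mul, mul_one]
    simp only [mul_assoc]
  rw [map_sub, h, h]

/-- The vector field on the open cell given by a matrix. -/
def cellField (x : Matrix (Fin (n + 1)) (Fin (n + 1)) ℂ) : Derivation ℂ (CellRing n) (CellRing n) :=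
  -- If `u exp(sx) = b(s) u(s)` with `b` lower triangular and `u` unipotent upper triangular,
  -- differentiating at `s = 0` gives `u' = (u x u⁻¹)₊ u`, the value prescribed here; the diagonal
  -- of `b'` supplies the twist in `cellAct`. Variables on or below the diagonal are inert.
  MvPolynomial.mkDerivation ℂ fun p => (upperPart (cellConj x) * genericUnipotent n) p.1 p.2

lemma cellField_X (x : Matrix (Fin (n + 1)) (Fin (n + 1)) ℂ) (p) :
    cellField x (MvPolynomial.X p) = (upperPart (cellConj x) * genericUnipotent n) p.1 p.2 :=
  MvPolynomial.mkDerivation_X _ _ _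

lemma upperPart_mul_genericUnipotent_apply (a : Matrix (Fin (n + 1)) (Fin (n + 1)) (CellRing n))
    {i j : Fin (n + 1)} (h : j ≤ i) : (upperPart a * genericUnipotent n) i j = 0 := by
  rw [genericUnipotent, mul_add, mul_one, Matrix.add_apply, upperPart_mul_upperPart_apply _ _ h,
    upperPart_apply, if_neg h.not_gt, add_zero]

lemma map_cellField_genericUnipotent (x : Matrix (Fin (n + 1)) (Fin (n + 1)) ℂ) :
    (genericUnipotent n).map (cellField x) = upperPart (cellConj x) * genericUnipotent n := by
  ext1 i j
  by_cases h : i < j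
  · simp [genericUnipotent, upperPart_apply _ i j, h, Matrix.one_apply_ne h.ne, cellField_X, mul_add]
  · rw [upperPart_mul_genericUnipotent_apply _ (not_lt.1 h)]
    simp only [genericUnipotent, Matrix.map_apply, Matrix.add_apply, upperPart_apply, if_neg h,
      zero_add, Matrix.one_apply]
    split_ifs <;> simp

lemma map_cellField_genericUnipotent_inv (x : Matrix (Fin (n + 1)) (Fin (n + 1)) ℂ) :
    (genericUnipotent n)⁻¹.map (cellField x) =
      -((genericUnipotent n)⁻¹ * upperPart (cellConj x)) := by
  have h := map_derivation_mul (cellField x) (genericUnipotent n) (genericUnipotent n)⁻¹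
  rw [genericUnipotent_mul_inv, map_cellField_genericUnipotent, mul_assoc,
    genericUnipotent_mul_inv, mul_one] at h
  have h0 : (1 : Matrix (Fin (n + 1)) (Fin (n + 1)) (CellRing n)).map (cellField x) = 0 := by
    ext1 i j; rw [Matrix.map_apply, Matrix.one_apply]; split_ifs <;> simp
  rw [h0] at h
  have h1 := congrArg ((genericUnipotent n)⁻¹ * ·) h
  simp only [mul_zero, mul_add, ← mul_assoc, genericUnipotent_inv_mul, one_mul] at h1
  exact (neg_eq_of_add_eq_zero_right h1.symm).symm

lemma map_cellField_cellConj (x y : Matrix (Fin (n + 1)) (Fin (n + 1)) ℂ) :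
    (cellConj y).map (cellField x) =
      upperPart (cellConj x) * cellConj y - cellConj y * upperPart (cellConj x) := by
  have h0 : (y.map (MvPolynomial.C : ℂ →+* CellRing n)).map (cellField x) = 0 := by
    ext1 i j; simp
  rw [cellConj_apply y, map_derivation_mul, map_derivation_mul, map_cellField_genericUnipotent,
    map_cellField_genericUnipotent_inv, h0]
  simp only [mul_zero, add_zero, mul_neg, ← sub_eq_add_neg, mul_assoc]

lemma map_upperPart (D : Derivation ℂ (CellRing n) (CellRing n))
    (a : Matrix (Fin (n + 1)) (Fin (n + 1)) (CellRing n)) :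
    (upperPart a).map D = upperPart (a.map D) := by
  ext1 i j; simp only [Matrix.map_apply, upperPart_apply]; split_ifs <;> simp

/-- Both sides are derivations, so it suffices to compare them on the variables, where the Leibniz
rule reduces the claim to `upperPart_commutator`. -/
lemma cellField_commutator (x y : Matrix (Fin (n + 1)) (Fin (n + 1)) ℂ) :
    cellField (x * y - y * x) = ⁅cellField x, cellField y⁆ := by
  refine MvPolynomial.derivation_ext fun p => ?_
  obtain ⟨i, j⟩ := p
  rw [Derivation.commutator_apply]
  simp only [cellField_X]
  have key : upperPart (cellConj (x * y - y * x)) * genericUnipotent n =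
      (upperPart (cellConj y) * genericUnipotent n).map (cellField x) -
      (upperPart (cellConj x) * genericUnipotent n).map (cellField y) := by
    rw [map_derivation_mul, map_derivation_mul, map_cellField_genericUnipotent,
      map_cellField_genericUnipotent, map_upperPart, map_upperPart, map_cellField_cellConj,
      map_cellField_cellConj, cellConj_commutator, upperPart_commutator]
    noncomm_ring
  exact congrFun (congrFun key i) j

/-- A linear functional on diagonal parts that takes the value `lam i` at `h_i`. -/
def diagWeight (lam : Fin n → ℂ) :
    Matrix (Fin (n + 1)) (Fin (n + 1)) (CellRing n) →ₗ[CellRing n] CellRing n where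
  -- The coefficient of `a j j` is the sum of `lam i` over `i ≥ j` (zero for the last `j`), so
  -- consecutive coefficients differ by `lam i`.
  toFun a := ∑ j : Fin (n + 1),
    MvPolynomial.C (∑ i : Fin n, if j ≤ i.castSucc then lam i else 0) * a j j
  map_add' a b := by simp [mul_add, Finset.sum_add_distrib]
  map_smul' c a := by
    simp only [Matrix.smul_apply, smul_eq_mul, RingHom.id_apply, Finset.mul_sum]
    exact Finset.sum_congr rfl fun _ _ => by ring

lemma diagWeight_apply (lam : Fin n → ℂ) (a : Matrix (Fin (n + 1)) (Fin (n + 1)) (CellRing n)) :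
    diagWeight lam a = ∑ j : Fin (n + 1),
      MvPolynomial.C (∑ i : Fin n, if j ≤ i.castSucc then lam i else 0) * a j j := rfl

lemma diagWeight_commutator (lam : Fin n → ℂ)
    (a b : Matrix (Fin (n + 1)) (Fin (n + 1)) (CellRing n)) :
    diagWeight lam (a * b - b * a) = diagWeight lam (upperPart a * b - b * upperPart a)
      - diagWeight lam (upperPart b * a - a * upperPart b) := by
  simp only [diagWeight_apply, diag_commutator a b, mul_sub, Finset.sum_sub_distrib]

lemma derivation_diagWeight (lam : Fin n → ℂ) (D : Derivation ℂ (CellRing n) (CellRing n))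
    (a : Matrix (Fin (n + 1)) (Fin (n + 1)) (CellRing n)) :
    D (diagWeight lam a) = diagWeight lam (a.map D) := by
  simp only [diagWeight_apply, map_sum, Derivation.leibniz, Matrix.map_apply]
  refine Finset.sum_congr rfl fun j _ => ?_
  have : ∀ c : ℂ, D (MvPolynomial.C c) = 0 := fun c => D.map_algebraMap c
  simp [this]

/-- The action of a matrix on the open cell, twisted by a weight. -/
def cellAct (lam : Fin n → ℂ) : Matrix (Fin (n + 1)) (Fin (n + 1)) ℂ →ₗ[ℂ]
    Module.End ℂ (CellRing n) where
  toFun x := (cellField x : CellRing n →ₗ[ℂ] CellRing n) +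
    LinearMap.mulLeft ℂ (diagWeight lam (cellConj x))
  map_add' x y := by
    have h : cellField (x + y) = cellField x + cellField y := by
      refine MvPolynomial.derivation_ext fun p => ?_
      simp [cellField_X, upperPart_add, add_mul]
    rw [h]
    refine LinearMap.ext fun f => ?_
    simp [add_mul]; ring
  map_smul' c x := by
    have h : cellField (c • x) = c • cellField x := by
      refine MvPolynomial.derivation_ext fun p => ?_
      simp [cellField_X, upperPart_smul]
    rw [h]
    refine LinearMap.ext fun f => ?_
    simp

lemma cellAct_apply (lam : Fin n → ℂ) (x : Matrix (Fin (n + 1)) (Fin (n + 1)) ℂ) (f : CellRing n) :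
    cellAct lam x f = cellField x f + diagWeight lam (cellConj x) * f := rfl

/-- The representation of `sl(n+1)` on polynomial functions on the open cell. -/
def cellRep (lam : Fin n → ℂ) : Sl n →ₗ⁅ℂ⁆ Module.End ℂ (CellRing n) :=
  { (cellAct lam).comp (Sl n).subtype with
    map_lie' := by
      intro x y
      change cellAct lam (x.1 * y.1 - y.1 * x.1) =
        cellAct lam x.1 * cellAct lam y.1 - cellAct lam y.1 * cellAct lam x.1
      refine LinearMap.ext fun f => ?_
      rw [cellAct_apply, cellConj_commutator, diagWeight_commutator]
      simp only [LinearMap.sub_apply, Module.End.mul_apply, cellAct_apply, cellField_commutator,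
        Derivation.commutator_apply, map_add,
        Derivation.leibniz, derivation_diagWeight, map_cellField_cellConj, smul_eq_mul]
      ring }

lemma cellRep_apply (lam : Fin n → ℂ) (x : Sl n) (f : CellRing n) :
    cellRep lam x f = cellField x.1 f + diagWeight lam (cellConj x.1) * f := rfl

end OpenCell

/-! ### The highest weight coefficient on the open cell -/

section CellValues

variable {n : ℕ}

lemma isUpperTriangular_genericUnipotent : (genericUnipotent n).IsUpperTriangular := by
  intro i j hij
  have hij : j < i := hij
  simp [genericUnipotent, upperPart_apply, hij.not_gt, Matrix.one_apply_ne hij.ne']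

lemma genericUnipotent_diag (j : Fin (n + 1)) : genericUnipotent n j j = 1 := by
  simp [genericUnipotent, upperPart_apply]

lemma cellConj_diag {x : Matrix (Fin (n + 1)) (Fin (n + 1)) ℂ} (hx : x.IsUpperTriangular)
    (j : Fin (n + 1)) : cellConj x j j = MvPolynomial.C (x j j) := by
  have hC : (x.map (MvPolynomial.C : ℂ →+* CellRing n)).IsUpperTriangular := by
    intro i j hij
    simp [hx hij]
  have hI : ((genericUnipotent n)⁻¹).IsUpperTriangular := by
    let _ : Invertible (genericUnipotent n) :=
      ⟨_, genericUnipotent_inv_mul, genericUnipotent_mul_inv⟩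
    exact Matrix.blockTriangular_inv_of_blockTriangular isUpperTriangular_genericUnipotent
  have hdiag : ∀ a b : Matrix (Fin (n + 1)) (Fin (n + 1)) (CellRing n), a.IsUpperTriangular →
      b.IsUpperTriangular → (a * b) j j = a j j * b j j := by
    intro a b ha hb
    rw [Matrix.mul_apply, Finset.sum_eq_single j]
    · intro k _ hk
      rcases lt_or_gt_of_ne hk with h | h
      · rw [ha (show k < j from h), zero_mul]
      · rw [hb (show j < k from h), mul_zero]
    · simp
  have h1 : (genericUnipotent n)⁻¹ j j = 1 := by
    have := hdiag _ _ hI isUpperTriangular_genericUnipotent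
    rw [genericUnipotent_inv_mul, genericUnipotent_diag] at this
    simpa using this.symm
  rw [cellConj_apply, hdiag _ _ (isUpperTriangular_genericUnipotent.mul hC) hI,
    hdiag _ _ isUpperTriangular_genericUnipotent hC, genericUnipotent_diag, h1]
  simp

lemma map_constantCoeff_genericUnipotent :
    (genericUnipotent n).map MvPolynomial.constantCoeff = 1 := by
  ext1 i j
  simp only [genericUnipotent, Matrix.map_apply, Matrix.add_apply, upperPart_apply,
    Matrix.of_apply, Matrix.one_apply]
  split_ifs <;> simp

lemma map_constantCoeff_cellConj (x : Matrix (Fin (n + 1)) (Fin (n + 1)) ℂ) :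
    (cellConj x).map MvPolynomial.constantCoeff = x := by
  have h := congrArg (fun a => a.map (MvPolynomial.constantCoeff : CellRing n →+* ℂ))
    (genericUnipotent_mul_inv (n := n))
  simp only [Matrix.map_mul, map_constantCoeff_genericUnipotent, one_mul] at h
  rw [cellConj_apply, Matrix.map_mul, Matrix.map_mul, map_constantCoeff_genericUnipotent, h,
    one_mul, Matrix.map_one _ (map_zero _) (map_one _), mul_one]
  ext1 i j
  simp

/-- The constant coefficient is evaluation at the identity matrix, where the vector field has value
`upperPart x`. -/
lemma constantCoeff_cellField {x : Matrix (Fin (n + 1)) (Fin (n + 1)) ℂ}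
    (hx : ∀ i j, i < j → x i j = 0) (f : CellRing n) :
    MvPolynomial.constantCoeff (cellField x f) = 0 := by
  have h0 : (upperPart (cellConj x) * genericUnipotent n).map
      (MvPolynomial.constantCoeff : CellRing n →+* ℂ) = 0 := by
    rw [Matrix.map_mul, map_constantCoeff_genericUnipotent, mul_one]
    ext1 i j
    rw [Matrix.map_apply, upperPart_apply]
    split_ifs with h
    · simpa [hx i j h] using congrFun (congrFun (map_constantCoeff_cellConj x) i) j
    · simp
  induction f using MvPolynomial.induction_on with
  | C a => rw [show cellField x (MvPolynomial.C a) = 0 from (cellField x).map_algebraMap a, map_zero]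
  | add p q hp hq => rw [map_add, map_add, hp, hq, add_zero]
  | mul_X p i hp =>
    have := congrFun (congrFun h0 i.1) i.2
    rw [Matrix.map_apply] at this
    rw [Derivation.leibniz, cellField_X]
    simp [this]

lemma constantCoeff_diagWeight_cellConj (lam : Fin n → ℂ)
    (x : Matrix (Fin (n + 1)) (Fin (n + 1)) ℂ) :
    MvPolynomial.constantCoeff (diagWeight lam (cellConj x)) =
      ∑ j : Fin (n + 1), (∑ i : Fin n, if j ≤ i.castSucc then lam i else 0) * x j j := by
  rw [diagWeight_apply, map_sum]
  refine Finset.sum_congr rfl fun j _ => ?_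
  rw [map_mul, MvPolynomial.constantCoeff_C]
  congr 1
  exact congrFun (congrFun (map_constantCoeff_cellConj x) j) j

lemma diagWeight_cellConj (lam : Fin n → ℂ)
    {x : Matrix (Fin (n + 1)) (Fin (n + 1)) ℂ} (hx : x.IsUpperTriangular) :
    diagWeight lam (cellConj x) = MvPolynomial.C
      (∑ j : Fin (n + 1), (∑ i : Fin n, if j ≤ i.castSucc then lam i else 0) * x j j) := by
  rw [diagWeight_apply, map_sum]
  exact Finset.sum_congr rfl fun j _ => by rw [cellConj_diag hx, map_mul]

lemma chevE_val (i : Fin n) : (chevE i).1 = Matrix.single i.castSucc i.succ (1 : ℂ) := rfl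

lemma chevF_val (i : Fin n) : (chevF i).1 = Matrix.single i.succ i.castSucc (1 : ℂ) := rfl

lemma chevH_val (i : Fin n) : (chevH i).1 =
    Matrix.single i.castSucc i.castSucc (1 : ℂ) - Matrix.single i.succ i.succ 1 := rfl

lemma sum_weight_chevH (lam : Fin n → ℂ) (i : Fin n) :
    ∑ j : Fin (n + 1), (∑ k : Fin n, if j ≤ k.castSucc then lam k else 0) * (chevH i).1 j j =
      lam i := by
  simp only [chevH_val, Matrix.sub_apply, mul_sub, Finset.sum_sub_distrib]
  rw [Finset.sum_eq_single i.castSucc, Finset.sum_eq_single i.succ]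
  · simp only [Matrix.single_apply_same, mul_one, ← Finset.sum_sub_distrib]
    rw [Finset.sum_eq_single i]
    · simp
    · intro k _ hk
      have h : i.succ ≤ k.castSucc ↔ i.castSucc ≤ k.castSucc := by
        simp only [Fin.le_def, Fin.val_succ, Fin.val_castSucc]
        have : (k : ℕ) ≠ i := fun h => hk (Fin.ext h)
        omega
      simp only [h, sub_self]
    · simp
  · intro j _ hj; rw [Matrix.single_apply_of_ne (h := fun h => hj h.1.symm), mul_zero]
  · simp
  · intro j _ hj; rw [Matrix.single_apply_of_ne (h := fun h => hj h.1.symm), mul_zero]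
  · simp

lemma cellRep_chevE_one (lam : Fin n → ℂ) (i : Fin n) : cellRep lam (chevE i) 1 = 0 := by
  have hx : (chevE i).1.IsUpperTriangular := by
    intro j k hjk
    have hjk : k < j := hjk
    rw [chevE_val, Matrix.single_apply_of_ne]
    rintro ⟨rfl, rfl⟩
    exact absurd hjk Fin.castSucc_lt_succ.not_gt
  rw [cellRep_apply, diagWeight_cellConj lam hx, Finset.sum_eq_zero]
  · simp
  · intro j _
    rw [chevE_val, Matrix.single_apply_of_ne, mul_zero]
    rintro ⟨h1, h2⟩
    exact Fin.castSucc_lt_succ.ne (h1.trans h2.symm)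

lemma chevH_apply_of_ne (i : Fin n) {j k : Fin (n + 1)} (h : j ≠ k) : (chevH i).1 j k = 0 := by
  rw [chevH_val, Matrix.sub_apply, Matrix.single_apply_of_ne, Matrix.single_apply_of_ne, sub_zero] <;>
  · rintro ⟨rfl, h2⟩; exact h h2

lemma cellRep_chevH_one (lam : Fin n → ℂ) (i : Fin n) :
    cellRep lam (chevH i) 1 = lam i • (1 : CellRing n) := by
  have hx : (chevH i).1.IsUpperTriangular := fun j k hjk =>
    chevH_apply_of_ne i (show k < j from hjk).ne'
  rw [cellRep_apply, diagWeight_cellConj lam hx, sum_weight_chevH, MvPolynomial.smul_eq_C_mul]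
  simp

lemma constantCoeff_cellRep_chevF (lam : Fin n → ℂ) (i : Fin n) (f : CellRing n) :
    MvPolynomial.constantCoeff (cellRep lam (chevF i) f) = 0 := by
  rw [cellRep_apply, map_add, map_mul, constantCoeff_cellField,
    constantCoeff_diagWeight_cellConj, Finset.sum_eq_zero]
  · simp
  · intro j _
    rw [chevF_val, Matrix.single_apply_of_ne, mul_zero]
    rintro ⟨h1, h2⟩
    exact Fin.castSucc_lt_succ.ne (h2.trans h1.symm)
  · intro j k hjk
    rw [chevF_val, Matrix.single_apply_of_ne]
    rintro ⟨rfl, rfl⟩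
    exact absurd hjk Fin.castSucc_lt_succ.not_gt

lemma constantCoeff_cellRep_chevH (lam : Fin n → ℂ) (i : Fin n) (f : CellRing n) :
    MvPolynomial.constantCoeff (cellRep lam (chevH i) f) =
      lam i * MvPolynomial.constantCoeff f := by
  rw [cellRep_apply, map_add, map_mul, constantCoeff_cellField,
    constantCoeff_diagWeight_cellConj, sum_weight_chevH, zero_add]
  exact fun j k hjk => chevH_apply_of_ne i hjk.ne

end CellValues

/-! ### The Verma module and its Shapovalov form -/

section VermaForm

variable {n : ℕ}

lemma verma_lie_def (lam : Fin n → ℂ) (x : Sl n) (y : Verma lam) :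
    ⁅x, y⁆ = UniversalEnvelopingAlgebra.ι ℂ x • y := rfl

lemma vermaVec_def (lam : Fin n → ℂ) : vermaVec lam = (vermaIdeal lam).mkQ 1 := rfl

lemma smul_vermaVec (lam : Fin n → ℂ) (u : USl n) :
    u • vermaVec lam = (vermaIdeal lam).mkQ u := by
  rw [vermaVec_def]
  exact ((vermaIdeal lam).mkQ.map_smul u 1).symm.trans (by rw [smul_eq_mul, mul_one])

lemma chevE_vermaVec (lam : Fin n → ℂ) (i : Fin n) : ⁅chevE i, vermaVec lam⁆ = 0 := by
  rw [verma_lie_def, smul_vermaVec]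
  exact (Submodule.Quotient.mk_eq_zero _).2 (Submodule.subset_span (Or.inl ⟨i, rfl⟩))

lemma chevH_vermaVec (lam : Fin n → ℂ) (i : Fin n) :
    ⁅chevH i, vermaVec lam⁆ = lam i • vermaVec lam := by
  rw [verma_lie_def, ← algebraMap_smul (USl n) (lam i), ← sub_eq_zero, ← sub_smul, smul_vermaVec]
  exact (Submodule.Quotient.mk_eq_zero _).2 (Submodule.subset_span (Or.inr ⟨i, rfl⟩))

/-- The universal property of the Verma module. -/
lemma exists_vermaLift (lam : Fin n → ℂ) {M : Type*} [AddCommGroup M] [Module ℂ M]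
    (ρ : Sl n →ₗ⁅ℂ⁆ Module.End ℂ M) (w : M) (he : ∀ i, ρ (chevE i) w = 0)
    (hh : ∀ i, ρ (chevH i) w = lam i • w) :
    ∃ F : Verma lam →ₗ[ℂ] M, F (vermaVec lam) = w ∧ ∀ x y, F ⁅x, y⁆ = ρ x (F y) := by
  let τ : USl n →ₐ[ℂ] Module.End ℂ M := UniversalEnvelopingAlgebra.lift ℂ ρ
  have hτ : ∀ x, τ (UniversalEnvelopingAlgebra.ι ℂ x) = ρ x := fun x =>
    UniversalEnvelopingAlgebra.lift_ι_apply ℂ ρ x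
  -- Semilinearity along `τ` lets the quotient by the left ideal be lifted without making `M` a
  -- module over the enveloping algebra.
  let f : USl n →ₛₗ[τ.toRingHom] M :=
    { toFun := fun u => τ u w
      map_add' := fun a b => by simp
      map_smul' := fun a b => by simp }
  have hf : vermaIdeal lam ≤ LinearMap.ker f := by
    refine Submodule.span_le.2 ?_
    rintro _ (⟨i, rfl⟩ | ⟨i, rfl⟩)
    · change τ _ w = 0
      rw [hτ, he]
    · change τ _ w = 0
      rw [map_sub, hτ, AlgHom.commutes, LinearMap.sub_apply, hh, Module.algebraMap_end_apply,
        sub_self]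
  let G : Verma lam →ₛₗ[τ.toRingHom] M := (vermaIdeal lam).liftQ f hf
  have hG : ∀ (u : USl n) (y : Verma lam), G (u • y) = τ u (G y) := fun u y => G.map_smulₛₗ u y
  refine ⟨{ toFun := G, map_add' := G.map_add, map_smul' := fun c y => ?_ }, ?_, fun x y => ?_⟩
  · rw [← algebraMap_smul (USl n) c y, hG, AlgHom.commutes]
    rfl
  · change τ 1 w = w
    simp
  · change G _ = ρ x (G y)
    rw [verma_lie_def, hG, hτ]

/-- Transposition of traceless matrices. -/
def slTranspose : Sl n →ₗ[ℂ] Sl n where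
  toFun x := ⟨x.1.transpose,
    (Matrix.trace_transpose x.1).trans x.2⟩
  map_add' _ _ := Subtype.ext (Matrix.transpose_add _ _)
  map_smul' _ _ := Subtype.ext (Matrix.transpose_smul _ _)

lemma slTranspose_lie (x y : Sl n) : slTranspose ⁅x, y⁆ = ⁅slTranspose y, slTranspose x⁆ := by
  refine Subtype.ext ?_
  change (x.1 * y.1 - y.1 * x.1).transpose = y.1.transpose * x.1.transpose -
    x.1.transpose * y.1.transpose
  rw [Matrix.transpose_sub, Matrix.transpose_mul, Matrix.transpose_mul]

lemma slTranspose_chevE (i : Fin n) : slTranspose (chevE i) = chevF i :=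
  Subtype.ext (Matrix.transpose_single _ _ _)

lemma slTranspose_chevF (i : Fin n) : slTranspose (chevF i) = chevE i :=
  Subtype.ext (Matrix.transpose_single _ _ _)

lemma slTranspose_chevH (i : Fin n) : slTranspose (chevH i) = chevH i := by
  refine Subtype.ext ?_
  change (chevH i).1.transpose = (chevH i).1
  rw [chevH_val, Matrix.transpose_sub, Matrix.transpose_single, Matrix.transpose_single]

/-- The contragredient representation on the dual of a representation. -/
def contragredient (n : ℕ) (V : Type*) [AddCommGroup V] [Module ℂ V] [LieRingModule (Sl n) V]
    [LieModule ℂ (Sl n) V] : Sl n →ₗ⁅ℂ⁆ Module.End ℂ (Module.Dual ℂ V) where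
  toFun x := Module.Dual.transpose (LieModule.toEnd ℂ (Sl n) V (slTranspose x))
  map_add' x y := by simp
  map_smul' c x := by simp
  map_lie' := by
    intro x y
    refine LinearMap.ext fun ψ => LinearMap.ext fun v => ?_
    change ψ ⁅slTranspose ⁅x, y⁆, v⁆ = ψ ⁅slTranspose y, ⁅slTranspose x, v⁆⁆ -
      ψ ⁅slTranspose x, ⁅slTranspose y, v⁆⁆
    rw [slTranspose_lie, lie_lie, map_sub]

lemma contragredient_apply {V : Type*} [AddCommGroup V] [Module ℂ V] [LieRingModule (Sl n) V]
    [LieModule ℂ (Sl n) V] (x : Sl n) (ψ : Module.Dual ℂ V) (v : V) :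
    contragredient n V x ψ v = ψ ⁅slTranspose x, v⁆ := rfl

/-- The constant polynomial 1 is a highest weight vector of weight `λ` in the cell representation,
so `v_λ` maps to it; `φ` is then evaluation at the identity. No PBW basis is needed. -/
lemma exists_vermaCoeff (lam : Fin n → ℂ) : ∃ φ : Module.Dual ℂ (Verma lam),
    φ (vermaVec lam) = 1 ∧ (∀ (i : Fin n) y, φ ⁅chevF i, y⁆ = 0) ∧
      ∀ (i : Fin n) y, φ ⁅chevH i, y⁆ = lam i * φ y := by
  obtain ⟨F, hF, hl⟩ := exists_vermaLift lam (cellRep lam) 1 (cellRep_chevE_one lam)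
    (cellRep_chevH_one lam)
  let ε : CellRing n →ₗ[ℂ] ℂ :=
    { toFun := MvPolynomial.constantCoeff
      map_add' := map_add _
      map_smul' := fun c f => by simp [MvPolynomial.smul_eq_C_mul] }
  refine ⟨ε ∘ₗ F, ?_, fun i y => ?_, fun i y => ?_⟩
  · change MvPolynomial.constantCoeff (F _) = 1
    rw [hF, map_one]
  · change MvPolynomial.constantCoeff (F _) = 0
    rw [hl, constantCoeff_cellRep_chevF]
  · change MvPolynomial.constantCoeff (F _) = _ * MvPolynomial.constantCoeff (F _)
    rw [hl, constantCoeff_cellRep_chevH]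

/-- The functional `φ` is a highest weight vector of weight `λ` in the contragredient dual, so the
universal property yields a map from the Verma module to its dual, which is a contravariant form. -/
theorem exists_isShapovalovForm_verma (lam : Fin n → ℂ) :
    ∃ B, IsShapovalovForm n (vermaVec lam) B := by
  obtain ⟨φ, h1, hf, hh⟩ := exists_vermaCoeff lam
  obtain ⟨F, hF, hl⟩ := exists_vermaLift lam (contragredient n (Verma lam)) φ
    (fun i => by
      ext y; rw [contragredient_apply, slTranspose_chevE, hf]; rfl)
    (fun i => by
      ext y; rw [contragredient_apply, slTranspose_chevH, hh]; rfl)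
  have hE : ∀ i x y, F ⁅chevE i, x⁆ y = F x ⁅chevF i, y⁆ := fun i x y => by
    rw [hl, contragredient_apply, slTranspose_chevE]
  have hF' : ∀ i x y, F ⁅chevF i, x⁆ y = F x ⁅chevE i, y⁆ := fun i x y => by
    rw [hl, contragredient_apply, slTranspose_chevF]
  -- Averaging with the flip forces symmetry. Contravariance survives because `F` intertwines both
  -- `e_i` with `f_i` and `f_i` with `e_i`.
  refine ⟨(2⁻¹ : ℂ) • (F + LinearMap.flip F), fun x y => ?_, fun i x y => ?_, ?_⟩
  · simp [add_comm]
  · simp [hE, hF']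
  · simp only [LinearMap.smul_apply, LinearMap.add_apply, LinearMap.flip_apply, hF, h1]
    norm_num

lemma shapovalovForm_spec {V : Type*} [AddCommGroup V] [Module ℂ V] [LieRingModule (Sl n) V]
    {v : V} (h : ∃ B, IsShapovalovForm n v B) : IsShapovalovForm n v (shapovalovForm n v) := by
  rw [shapovalovForm, dif_pos h]
  exact h.choose_spec

lemma isShapovalovForm_verma (lam : Fin n → ℂ) :
    IsShapovalovForm n (vermaVec lam) (shapovalovForm n (vermaVec lam)) :=
  shapovalovForm_spec (exists_isShapovalovForm_verma lam)

end VermaForm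

/-! ### The linear representation -/

section Linear

variable {n : ℕ}

lemma linRep_lie_def (x : Sl n) (w : LinRep n) : ⁅x, w⁆ = x.1.mulVec w := rfl

lemma chevF_single (i : Fin n) (k : Fin (n + 1)) :
    ⁅chevF i, (Pi.single k 1 : LinRep n)⁆ = if k = i.castSucc then Pi.single i.succ 1 else 0 := by
  rw [linRep_lie_def, chevF_val, Matrix.mulVec_single_one]
  ext j
  split_ifs with h
  · subst h
    simp [Matrix.single_apply, Pi.single_apply, eq_comm]
  · simp [Ne.symm h]

lemma chevE_single (i : Fin n) (k : Fin (n + 1)) :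
    ⁅chevE i, (Pi.single k 1 : LinRep n)⁆ = if k = i.succ then Pi.single i.castSucc 1 else 0 := by
  rw [linRep_lie_def, chevE_val, Matrix.mulVec_single_one]
  ext j
  split_ifs with h
  · subst h
    simp [Matrix.single_apply, Pi.single_apply, eq_comm]
  · simp [Ne.symm h]

theorem exists_isShapovalovForm_linRep : ∃ B, IsShapovalovForm n (linVec n) B := by
  refine ⟨dotProductBilin ℂ ℂ, fun x y => dotProduct_comm x y, fun i x y => ?_, ?_⟩
  · change (chevE i).1.mulVec x ⬝ᵥ y = x ⬝ᵥ (chevF i).1.mulVec y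
    rw [Matrix.dotProduct_mulVec, ← Matrix.mulVec_transpose]
    congr 2
    exact (congrArg Subtype.val (slTranspose_chevF i)).symm
  · change linVec n ⬝ᵥ linVec n = 1
    simp [linVec]

lemma isShapovalovForm_linRep :
    IsShapovalovForm n (linVec n) (shapovalovForm n (linVec n)) :=
  shapovalovForm_spec exists_isShapovalovForm_linRep

/-- The form is obtained by choice, so only its axioms can be used: contravariance lowers both
indices together until the first reaches 0. -/
lemma shapovalovForm_linRep_single (k l : Fin (n + 1)) :
    shapovalovForm n (linVec n) (Pi.single k 1) (Pi.single l 1) = if k = l then 1 else 0 := by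
  have hB := isShapovalovForm_linRep (n := n)
  have h0 : ∀ l : Fin n, shapovalovForm n (linVec n) (Pi.single 0 1) (Pi.single l.succ 1) = 0 := by
    intro l
    have h := chevF_single l l.castSucc
    rw [if_pos rfl] at h
    rw [← h, ← hB.contravariant, chevE_single, if_neg (Fin.succ_ne_zero l).symm]
    simp
  induction k using Fin.induction generalizing l with
  | zero =>
    cases l using Fin.cases with
    | zero => rw [if_pos rfl]; exact hB.normalized
    | succ l => rw [h0, if_neg (Fin.succ_ne_zero l).symm]
  | succ k ih =>
    have h := chevF_single k k.castSucc
    rw [if_pos rfl] at h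
    rw [← h, hB.symm, ← hB.contravariant, chevE_single]
    by_cases hl : l = k.succ
    · rw [if_pos hl, if_pos hl.symm, ih, if_pos rfl]
    · rw [if_neg hl, if_neg (Ne.symm hl)]; simp

end Linear

/-! ### Chevalley relations on words -/

section Words

set_option linter.unusedSectionVars false

variable {n : ℕ}

/-- Adjacency of nodes of the Dynkin diagram. -/
def Adjacent (i j : Fin n) : Prop := (i : ℕ) + 1 = j ∨ (j : ℕ) + 1 = i

instance (i j : Fin n) : Decidable (Adjacent i j) := inferInstanceAs (Decidable (_ ∨ _))

lemma lie_chevE_chevF_same (i : Fin n) : ⁅chevE i, chevF i⁆ = chevH i := by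
  refine Subtype.ext ?_
  change (chevE i).1 * (chevF i).1 - (chevF i).1 * (chevE i).1 = _
  rw [chevE_val, chevF_val, chevH_val, Matrix.single_mul_single_same,
    Matrix.single_mul_single_same, mul_one]

lemma lie_chevE_chevF_of_ne {i j : Fin n} (h : i ≠ j) : ⁅chevE i, chevF j⁆ = 0 := by
  refine Subtype.ext ?_
  change (chevE i).1 * (chevF j).1 - (chevF j).1 * (chevE i).1 = 0
  rw [chevE_val, chevF_val, Matrix.single_mul_single_of_ne, Matrix.single_mul_single_of_ne,
    sub_zero]
  · exact fun e => h (Fin.castSucc_injective _ e).symm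
  · exact fun e => h (Fin.succ_injective _ e)

lemma lie_chevH_chevF_of_ne {i j : Fin n} (h : i ≠ j) :
    ⁅chevH i, chevF j⁆ = (if Adjacent i j then (1 : ℂ) else 0) • chevF j := by
  refine Subtype.ext ?_
  change (chevH i).1 * (chevF j).1 - (chevF j).1 * (chevH i).1 =
    (if Adjacent i j then (1 : ℂ) else 0) • (chevF j).1
  rw [chevF_val, chevH_val, sub_mul, mul_sub,
    Matrix.single_mul_single_of_ne (i := i.succ) (j := i.succ) (k := j.succ)
      (h := fun e => h (Fin.succ_injective _ e)),
    Matrix.single_mul_single_of_ne (i := j.succ) (j := j.castSucc) (k := i.castSucc)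
      (h := fun e => h (Fin.castSucc_injective _ e).symm)]
  by_cases h1 : i.castSucc = j.succ
  · have h1' : (i : ℕ) = j + 1 := congrArg Fin.val h1
    have h2 : j.castSucc ≠ i.succ := fun e => by
      have : (j : ℕ) = i + 1 := congrArg Fin.val e
      omega
    rw [h1, Matrix.single_mul_single_same, Matrix.single_mul_single_of_ne (h := h2),
      if_pos (show Adjacent i j from Or.inr h1'.symm)]
    simp
  · rw [Matrix.single_mul_single_of_ne (h := h1)]
    by_cases h2 : j.castSucc = i.succ
    · have h2' : (j : ℕ) = i + 1 := congrArg Fin.val h2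
      rw [h2, Matrix.single_mul_single_same, if_pos (show Adjacent i j from Or.inl h2'.symm)]
      simp
    · rw [Matrix.single_mul_single_of_ne (h := h2), if_neg]
      · simp
      · rintro (e | e)
        · exact h2 (Fin.ext e.symm)
        · exact h1 (Fin.ext e.symm)

lemma fWord_cons {V : Type*} [AddCommGroup V] [LieRingModule (Sl n) V]
    (i : Fin n) (I : List (Fin n)) (v : V) :
    fWord (i :: I) v = ⁅chevF i, fWord I v⁆ := rfl

variable {V : Type*} [AddCommGroup V] [Module ℂ V] [LieRingModule (Sl n) V]
  [LieModule ℂ (Sl n) V]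

lemma chevE_fWord_cons_of_ne {i j : Fin n} (h : i ≠ j) (I : List (Fin n)) (v : V) :
    ⁅chevE i, fWord (j :: I) v⁆ = ⁅chevF j, ⁅chevE i, fWord I v⁆⁆ := by
  rw [fWord_cons, leibniz_lie, lie_chevE_chevF_of_ne h, zero_lie, zero_add]

lemma chevE_fWord_of_notMem {v : V} {i : Fin n} (hv : ⁅chevE i, v⁆ = 0) {I : List (Fin n)}
    (hI : i ∉ I) : ⁅chevE i, fWord I v⁆ = 0 := by
  induction I with
  | nil => exact hv
  | cons j I ih =>
    rw [List.mem_cons, not_or] at hI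
    rw [chevE_fWord_cons_of_ne hI.1, ih hI.2, lie_zero]

/-- The eigenvalue of `h_i` on `f^I v`, for a word `I` without the letter `i`. -/
def wordWeight (lam : Fin n → ℂ) (i : Fin n) (I : List (Fin n)) : ℂ :=
  lam i + (I.map fun j => if Adjacent i j then (1 : ℂ) else 0).sum

lemma wordWeight_cons (lam : Fin n → ℂ) (i j : Fin n) (I : List (Fin n)) :
    wordWeight lam i (j :: I) = wordWeight lam i I + if Adjacent i j then 1 else 0 := by
  simp only [wordWeight, List.map_cons, List.sum_cons]; ring

lemma chevH_fWord_of_notMem {lam : Fin n → ℂ} {v : V} {i : Fin n}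
    (hv : ⁅chevH i, v⁆ = lam i • v) {I : List (Fin n)} (hI : i ∉ I) :
    ⁅chevH i, fWord I v⁆ = wordWeight lam i I • fWord I v := by
  induction I with
  | nil => simpa [wordWeight, fWord] using hv
  | cons j I ih =>
    rw [List.mem_cons, not_or] at hI
    rw [fWord_cons, leibniz_lie, lie_chevH_chevF_of_ne hI.1, ih hI.2, smul_lie, lie_smul,
      wordWeight_cons, add_smul, add_comm]

lemma chevE_fWord_cons_same {lam : Fin n → ℂ} {v : V} {i : Fin n}
    (he : ⁅chevE i, v⁆ = 0) (hh : ⁅chevH i, v⁆ = lam i • v) {I : List (Fin n)} (hI : i ∉ I) :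
    ⁅chevE i, fWord (i :: I) v⁆ = wordWeight lam i I • fWord I v := by
  rw [fWord_cons, leibniz_lie, lie_chevE_chevF_same, chevE_fWord_of_notMem he hI, lie_zero,
    add_zero, chevH_fWord_of_notMem hh hI]

end Words

/-! ### Weight functions and their insertion identity -/

section Insertion

set_option linter.unusedSectionVars false

variable {n : ℕ}

/-- `1 / ((x - t_{i_1}) (t_{i_1} - t_{i_2}) ⋯ (t_{i_m} - z))`. -/
def leftChain (t : Fin n → ℂ) (z : ℂ) : ℂ → List (Fin n) → ℂ
  | x, [] => (x - z)⁻¹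
  | x, i :: I => (x - t i)⁻¹ * leftChain t z (t i) I

lemma chainFun_cons (t : Fin n → ℂ) (z : ℂ) (i : Fin n) (I : List (Fin n)) :
    chainFun t z (i :: I) = leftChain t z (t i) I := by
  induction I generalizing i with
  | nil => rfl
  | cons j I ih => rw [chainFun, ih, leftChain]

/-- `λ_i / t_i + ∑ 1 / (t_i - t_j)`, the sum over the neighbours `j` of `i` in the word `I`. -/
def betheSum (lam t : Fin n → ℂ) (i : Fin n) (I : List (Fin n)) : ℂ :=
  lam i / t i + (I.map fun j => if Adjacent i j then (t i - t j)⁻¹ else 0).sum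

lemma betheSum_cons (lam t : Fin n → ℂ) (i j : Fin n) (I : List (Fin n)) :
    betheSum lam t i (j :: I) =
      betheSum lam t i I + if Adjacent i j then (t i - t j)⁻¹ else 0 := by
  simp only [betheSum, List.map_cons, List.sum_cons]; ring

lemma betheSum_perm (lam t : Fin n → ℂ) (i : Fin n) {I J : List (Fin n)} (h : I.Perm J) :
    betheSum lam t i I = betheSum lam t i J := by
  rw [betheSum, betheSum, (h.map _).sum_eq]

lemma lie_list_sum {V : Type*} [AddCommGroup V] [LieRingModule (Sl n) V]
    {ι : Type*} (x : Sl n) (l : List ι) (g : ι → V) :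
    ⁅x, (l.map g).sum⁆ = (l.map fun a => ⁅x, g a⁆).sum := by
  induction l with
  | nil => simp
  | cons a l ih => simp [ih]

variable {V : Type*} [AddCommGroup V] [Module ℂ V] [LieRingModule (Sl n) V]
  [LieModule ℂ (Sl n) V]

lemma smul_list_sum {ι : Type*} (c : ℂ) (l : List ι) (g : ι → V) :
    c • (l.map g).sum = (l.map fun a => c • g a).sum := by
  induction l with
  | nil => simp
  | cons a l ih => simp [ih]

/-- Here `i` is inserted at every place of `K`, to the right of a fixed letter `a`. The
contributions telescope: the eigenvalue of `h_i` jumps only when `i` passes a neighbour, and these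
jumps assemble `betheSum`; the term with `t i - t a` is the boundary term at the left end. -/
lemma sum_insert_leftChain {lam t : Fin n → ℂ} {v : V} {i : Fin n}
    (he : ⁅chevE i, v⁆ = 0) (hh : ⁅chevH i, v⁆ = lam i • v) (ht : ∀ j, t j ≠ 0)
    (hinj : Function.Injective t) {a : Fin n} {K : List (Fin n)} (hK : (a :: i :: K).Nodup) :
    ((List.permutations'Aux i K).map fun I => leftChain t 0 (t a) I • ⁅chevE i, fWord I v⁆).sum =
      (leftChain t 0 (t a) K * (betheSum lam t i K - wordWeight lam i K * (t i - t a)⁻¹)) •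
        fWord K v := by
  induction K generalizing a with
  | nil =>
    have hai : t i - t a ≠ 0 := sub_ne_zero.2 fun e => by
      have := hinj e; simp [this] at hK
    have hai' : t a - t i ≠ 0 := sub_ne_zero.2 (sub_ne_zero.1 hai).symm
    have h := chevE_fWord_cons_same he hh (I := []) (by simp)
    simp only [List.permutations'Aux, List.map_cons, List.map_nil, List.sum_cons, List.sum_nil,
      add_zero, h, smul_smul]
    congr 1
    simp only [leftChain, betheSum, wordWeight, List.map_nil, List.sum_nil, add_zero, sub_zero]
    have h1 := ht i
    have h2 := ht a
    field_simp
    ring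
  | cons k K ih =>
    have hik : i ≠ k := by rintro rfl; simp at hK
    have hiK : i ∉ k :: K := fun h => by simp at hK h; tauto
    have hsub : ∀ {b c : Fin n}, b ≠ c → t b - t c ≠ 0 := fun h => sub_ne_zero.2 (hinj.ne h)
    have hai : a ≠ i := by rintro rfl; simp at hK
    have hak : a ≠ k := by rintro rfl; simp at hK
    have hK' : (k :: i :: K).Nodup := by
      have := (List.nodup_cons.1 hK).2
      exact (List.Perm.swap k i K).nodup_iff.1 this
    have h := chevE_fWord_cons_same he hh hiK
    simp only [List.permutations'Aux, List.map_cons, List.map_map, List.sum_cons,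
      Function.comp_def, h, chevE_fWord_cons_of_ne hik, leftChain]
    have h2 : ∀ I : List (Fin n), ((t a - t k)⁻¹ * leftChain t 0 (t k) I) •
        ⁅chevF k, ⁅chevE i, fWord I v⁆⁆ =
        (t a - t k)⁻¹ • ⁅chevF k, leftChain t 0 (t k) I • ⁅chevE i, fWord I v⁆⁆ := by
      intro I
      rw [lie_smul, mul_smul]
    simp only [h2]
    rw [← smul_list_sum, ← lie_list_sum, ih hK', lie_smul, ← fWord_cons, smul_smul, smul_smul,
      ← add_smul]
    congr 1
    -- What remains is the partial fraction `1/((a-i)(i-k)) = (1/(a-k)) (1/(i-k) - 1/(i-a))`,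
    -- written with letters for coordinates: its first part cancels the boundary term of the
    -- induction hypothesis up to the jump of the weight at `k`.
    rw [betheSum_cons, wordWeight_cons]
    have e1 := hsub hai
    have e2 := hsub hai.symm
    have e3 := hsub hak
    have e4 := hsub hik
    split_ifs
    · field_simp
      ring
    · field_simp
      ring

/-- With nothing to the left of the insertion, the boundary term of `sum_insert_leftChain` is
cancelled by the word that starts with `i`. -/
lemma sum_insert_chainFun {lam t : Fin n → ℂ} {v : V} {i : Fin n}
    (he : ⁅chevE i, v⁆ = 0) (hh : ⁅chevH i, v⁆ = lam i • v) (ht : ∀ j, t j ≠ 0)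
    (hinj : Function.Injective t) {K : List (Fin n)} (hK : (i :: K).Nodup) :
    ((List.permutations'Aux i K).map fun I => chainFun t 0 I • ⁅chevE i, fWord I v⁆).sum =
      betheSum lam t i K • chainFun t 0 K • fWord K v := by
  cases K with
  | nil =>
    have h := chevE_fWord_cons_same he hh (I := []) (by simp)
    simp only [List.permutations'Aux, List.map_cons, List.map_nil, List.sum_cons, List.sum_nil,
      add_zero, h, smul_smul]
    congr 1
    simp only [chainFun, betheSum, wordWeight, List.map_nil, List.sum_nil, add_zero, sub_zero]
    ring
  | cons k K =>
    have hik : i ≠ k := by rintro rfl; simp at hK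
    have hiK : i ∉ k :: K := (List.nodup_cons.1 hK).1
    have hK' : (k :: i :: K).Nodup := (List.Perm.swap k i K).nodup_iff.1 hK
    have h := chevE_fWord_cons_same he hh hiK
    simp only [List.permutations'Aux, List.map_cons, List.map_map, List.sum_cons,
      Function.comp_def, h, chevE_fWord_cons_of_ne hik, chainFun_cons]
    have h2 : ∀ I : List (Fin n), leftChain t 0 (t k) I • ⁅chevF k, ⁅chevE i, fWord I v⁆⁆ =
        ⁅chevF k, leftChain t 0 (t k) I • ⁅chevE i, fWord I v⁆⁆ := fun I => (lie_smul _ _ _).symm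
    simp only [h2]
    rw [← lie_list_sum, sum_insert_leftChain he hh ht hinj hK', lie_smul, ← fWord_cons,
      smul_smul, smul_smul, ← add_smul]
    congr 1
    rw [betheSum_cons, wordWeight_cons, leftChain]
    split_ifs <;> ring

/-- `∑ c_{I,0}(t) f^I v`, the sum over all orderings `I` of the letters of `L`. -/
def wordSum (t : Fin n → ℂ) (v : V) (L : List (Fin n)) : V :=
  (L.permutations'.map fun I => chainFun t 0 I • fWord I v).sum

lemma wordSum_perm (t : Fin n → ℂ) (v : V) {L L' : List (Fin n)} (h : L.Perm L') :
    wordSum t v L = wordSum t v L' := (h.permutations'.map _).sum_eq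

lemma chevE_wordSum_of_notMem {t : Fin n → ℂ} {v : V} {i : Fin n} (he : ⁅chevE i, v⁆ = 0)
    {L : List (Fin n)} (hi : i ∉ L) : ⁅chevE i, wordSum t v L⁆ = 0 := by
  rw [wordSum, lie_list_sum]
  refine List.sum_eq_zero fun w hw => ?_
  obtain ⟨I, hI, rfl⟩ := List.mem_map.1 hw
  have hI' : i ∉ I := fun h => hi ((List.mem_permutations'.1 hI).mem_iff.1 h)
  rw [lie_smul, chevE_fWord_of_notMem he hI', smul_zero]

/-- Orderings are grouped by what is left after deleting `i`. Each group contributes the same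
factor, since `betheSum` depends only on the set of remaining letters. -/
lemma chevE_wordSum_cons {lam t : Fin n → ℂ} {v : V} {i : Fin n}
    (he : ⁅chevE i, v⁆ = 0) (hh : ⁅chevH i, v⁆ = lam i • v) (ht : ∀ j, t j ≠ 0)
    (hinj : Function.Injective t) {L : List (Fin n)} (hL : (i :: L).Nodup) :
    ⁅chevE i, wordSum t v (i :: L)⁆ = betheSum lam t i L • wordSum t v L := by
  rw [wordSum, lie_list_sum, wordSum, smul_list_sum]
  simp only [List.permutations', List.map_flatMap, lie_smul]
  rw [List.flatMap, List.sum_flatten, List.map_map]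
  refine congrArg List.sum (List.map_congr_left fun K hK => ?_)
  have hK' := List.mem_permutations'.1 hK
  rw [Function.comp_apply, sum_insert_chainFun he hh ht hinj ((hK'.cons i).nodup_iff.2 hL),
    betheSum_perm _ _ _ hK']

end Insertion

/-! ### The components of the Bethe vector -/

section Components

variable {n : ℕ}

/-- The word `k, k+1, …` of all letters from `k` on. -/
def tailWord (n k : ℕ) : List (Fin n) := (List.finRange n).drop k

/-- The word `k-1, …, 1, 0` of all letters below `k`, in descending order. -/
def headWord (n k : ℕ) : List (Fin n) := ((List.finRange n).take k).reverse

lemma tailWord_eq_cons (k : Fin n) : tailWord n k = k :: tailWord n (k + 1) := by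
  rw [tailWord, List.drop_eq_getElem_cons (by simp)]
  simp [tailWord]

lemma headWord_succ (k : Fin n) : headWord n (k + 1) = k :: headWord n k := by
  rw [headWord, List.take_succ_eq_append_getElem (by simp)]
  simp [headWord]

lemma tailWord_self : tailWord n n = [] := by simp [tailWord]

lemma headWord_zero : headWord n 0 = [] := by simp [headWord]

lemma length_tailWord (k : ℕ) : (tailWord n k).length = n - k := by simp [tailWord]

lemma nodup_tailWord (k : ℕ) : (tailWord n k).Nodup :=
  (List.nodup_finRange n).sublist (List.drop_sublist _ _)

lemma mem_tailWord {k : ℕ} {i : Fin n} : i ∈ tailWord n k ↔ k ≤ i := by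
  rw [tailWord, List.mem_drop_iff_getElem]
  constructor
  · rintro ⟨j, hj, h⟩
    simp at h
    rw [← h]; simp
  · intro h
    refine ⟨i - k, by simp; omega, ?_⟩
    ext
    simp; omega

lemma tailWord_append_headWord_perm (k : ℕ) :
    (tailWord n k ++ headWord n k).Perm (List.finRange n) :=
  ((List.reverse_perm _).append_left _).trans
    (List.perm_append_comm.trans (by rw [tailWord, List.take_append_drop]))

lemma fWord_headWord (k : Fin (n + 1)) : fWord (headWord n k) (linVec n) = Pi.single k 1 := by
  induction k using Fin.induction with
  | zero => simp [headWord_zero, fWord, linVec]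
  | succ k ih =>
    rw [Fin.val_castSucc] at ih
    rw [Fin.val_succ, headWord_succ, fWord_cons, ih, chevF_single, if_pos rfl]

/-- On the standard basis `f_j` is nonzero only at the `j`-th vector, so, read from the right, each
letter of a surviving word is forced. -/
lemma fWord_linVec_eq_zero {J : List (Fin n)} {k : Fin (n + 1)} (hlen : J.length = k)
    (hJ : J ≠ headWord n k) : fWord J (linVec n) = 0 := by
  induction J generalizing k with
  | nil =>
    rw [← hlen] at hJ
    exact absurd headWord_zero.symm hJ
  | cons j J ih =>
    cases k using Fin.cases with
    | zero => simp at hlen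
    | succ k =>
      rw [fWord_cons]
      by_cases h : J = headWord n k.castSucc
      · rw [h, fWord_headWord, chevF_single, if_neg]
        rintro e
        obtain rfl := Fin.castSucc_injective _ e
        exact hJ (by rw [Fin.val_succ, headWord_succ, h, Fin.val_castSucc])
      · rw [ih (k := k.castSucc) (by simpa using hlen) h, lie_zero]

lemma sum_perm_ofFn {M : Type*} [AddCommMonoid M] (G : List (Fin n) → M) :
    ∑ σ : Equiv.Perm (Fin n), G (List.ofFn σ) =
      ∑ L ∈ (List.finRange n).permutations'.toFinset, G L := by
  refine Finset.sum_nbij (fun σ => List.ofFn σ) ?_ ?_ ?_ fun _ _ => rfl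
  · intro σ _
    rw [List.mem_toFinset, List.mem_permutations',
      List.perm_ext_iff_of_nodup (List.nodup_ofFn.2 σ.injective) (List.nodup_finRange n)]
    intro a
    simpa [List.mem_ofFn] using σ.surjective a
  · intro σ _ τ _ h
    exact Equiv.ext (congrFun (List.ofFn_injective h))
  · intro L hL
    have hL : L.Perm (List.finRange n) := by simpa [List.mem_permutations'] using hL
    have hlen : L.length = n := by simpa using hL.length_eq
    have hnd : L.Nodup := hL.nodup_iff.2 (List.nodup_finRange n)
    have hinj : Function.Injective fun i : Fin n => L.get (i.cast hlen.symm) := fun a b h => by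
      simpa [Fin.ext_iff] using List.nodup_iff_injective_get.1 hnd h
    refine ⟨Equiv.ofBijective _ (Finite.injective_iff_bijective.1 hinj), by simp, ?_⟩
    refine List.ext_getElem (by simp [hlen]) fun i h1 h2 => ?_
    simp

lemma wordSum_eq_sum {V : Type*} [AddCommGroup V] [Module ℂ V] [LieRingModule (Sl n) V]
    (t : Fin n → ℂ) (v : V) {L : List (Fin n)} (hL : L.Nodup) :
    wordSum t v L = ∑ I ∈ L.permutations'.toFinset, chainFun t 0 I • fWord I v := by
  rw [wordSum, List.sum_toFinset _
    ((List.permutations_perm_permutations' _).nodup_iff.1 (List.nodup_permutations _ hL))]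

lemma sum_take_drop {M : Type*} [AddCommMonoid M] (F : List (Fin n) → List (Fin n) → M)
    {k : ℕ} (hk : k ≤ n) (hF : ∀ I J, J.length = k → J ≠ headWord n k → F I J = 0) :
    ∑ L ∈ (List.finRange n).permutations'.toFinset, F (L.take (n - k)) (L.drop (n - k)) =
      ∑ I ∈ (tailWord n k).permutations'.toFinset, F I (headWord n k) := by
  have hlen : ∀ L ∈ (List.finRange n).permutations'.toFinset, L.length = n := fun L hL => by
    rw [List.mem_toFinset, List.mem_permutations'] at hL
    simpa using hL.length_eq
  rw [← Finset.sum_filter_of_ne (p := fun L : List (Fin n) => L.drop (n - k) = headWord n k)]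
  · refine Finset.sum_nbij' (fun L => L.take (n - k)) (fun I => I ++ headWord n k) ?_ ?_ ?_ ?_ ?_
    · intro L hL
      rw [Finset.mem_filter, List.mem_toFinset, List.mem_permutations'] at hL
      rw [List.mem_toFinset, List.mem_permutations']
      have h := hL.1.trans (tailWord_append_headWord_perm k).symm
      rw [← L.take_append_drop (n - k), hL.2] at h
      exact (List.perm_append_right_iff _).1 h
    · intro I hI
      rw [List.mem_toFinset, List.mem_permutations'] at hI
      rw [Finset.mem_filter, List.mem_toFinset, List.mem_permutations']
      refine ⟨(hI.append_right _).trans (tailWord_append_headWord_perm k), ?_⟩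
      exact List.drop_left' (by rw [hI.length_eq, length_tailWord])
    · intro L hL
      rw [Finset.mem_filter] at hL
      rw [← hL.2, L.take_append_drop]
    · intro I hI
      rw [List.mem_toFinset, List.mem_permutations'] at hI
      exact List.take_left' (by rw [hI.length_eq, length_tailWord])
    · intro L hL
      rw [Finset.mem_filter] at hL
      rw [hL.2]
  · intro L hL hne
    by_contra h
    refine hne (hF _ _ ?_ h)
    rw [List.length_drop, hlen L hL]; omega

theorem betheVector_eq (lam t : Fin n → ℂ) :
    betheVector lam t = ∑ k : Fin (n + 1), chainFun t 1 (headWord n k) •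
      (wordSum t (vermaVec lam) (tailWord n k) ⊗ₜ[ℂ] (Pi.single k 1 : LinRep n)) := by
  rw [betheVector, sum_perm_ofFn (fun L => ∑ m ∈ Finset.range (n + 1),
    omegaFun (L.take m) (L.drop m) t •
      (fWord (L.take m) (vermaVec lam) ⊗ₜ[ℂ] fWord (L.drop m) (linVec n))), Finset.sum_comm,
    -- The reflection reindexes by the length `k = n - m` of the second word.
    ← Finset.sum_range_reflect, Finset.sum_range]
  refine Finset.sum_congr rfl fun k _ => ?_
  have hk : (k : ℕ) ≤ n := by omega
  rw [show n + 1 - 1 - (k : ℕ) = n - k by omega,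
    sum_take_drop (fun I J => omegaFun I J t • (fWord I (vermaVec lam) ⊗ₜ[ℂ] fWord J (linVec n))) hk,
    wordSum_eq_sum t _ (nodup_tailWord _), TensorProduct.sum_tmul, Finset.smul_sum]
  · refine Finset.sum_congr rfl fun I _ => ?_
    rw [fWord_headWord, omegaFun, mul_comm, mul_smul, TensorProduct.smul_tmul']
  · intro I J hJ hne
    rw [fWord_linVec_eq_zero hJ hne, TensorProduct.tmul_zero, smul_zero]

theorem betheTop_eq (lam t : Fin n → ℂ) :
    betheTop lam t = wordSum t (vermaVec lam) (tailWord n 0) := by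
  rw [betheTop, betheVector_eq, map_sum, map_sum, Finset.sum_eq_single 0]
  · simp [headWord_zero, chainFun]
  · intro k _ hk
    simp [hk.symm]
  · simp

theorem tensorForm_betheVector (lam t : Fin n → ℂ) :
    tensorForm lam (betheVector lam t) (betheVector lam t) =
      ∑ k : Fin (n + 1), chainFun t 1 (headWord n k) ^ 2 *
        shapovalovForm n (vermaVec lam) (wordSum t (vermaVec lam) (tailWord n k))
          (wordSum t (vermaVec lam) (tailWord n k)) := by
  rw [betheVector_eq, map_sum (tensorForm lam), LinearMap.sum_apply]
  refine Finset.sum_congr rfl fun k _ => ?_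
  rw [map_sum, Finset.sum_eq_single k]
  · simp only [map_smul, LinearMap.smul_apply, smul_eq_mul]
    rw [tensorForm, LinearMap.BilinForm.tensorDistrib_tmul, shapovalovForm_linRep_single,
      if_pos rfl]
    simp only [smul_eq_mul]; ring
  · intro l _ hl
    simp only [map_smul, LinearMap.smul_apply, smul_eq_mul]
    rw [tensorForm, LinearMap.BilinForm.tensorDistrib_tmul, shapovalovForm_linRep_single,
      if_neg hl.symm]
    simp
  · simp

end Components

/-! ### Critical points and the Bethe equations -/

section Critical

variable {n : ℕ}

/-- The coordinates of `t`, counted from `1`, with the `0`-th coordinate equal to `1`. -/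
def extCoord (t : Fin n → ℂ) : ℕ → ℂ
  | 0 => 1
  | k + 1 => if h : k < n then t ⟨k, h⟩ else 0

lemma extCoord_zero (t : Fin n → ℂ) : extCoord t 0 = 1 := rfl

lemma extCoord_succ (t : Fin n → ℂ) (k : Fin n) : extCoord t (k + 1) = t k := by
  simp [extCoord]

/-- The left-hand side of the `i`-th Bethe equation. -/
def betheEq (lam t : Fin n → ℂ) (i : Fin n) : ℂ :=
  lam i / t i + (t i - extCoord t i)⁻¹ +
    if h : (i : ℕ) + 1 < n then (t i - t ⟨i + 1, h⟩)⁻¹ else 0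

/-- The linear part of `linkForm`. -/
def linkLinear (j : Fin n) : (Fin n → ℂ) →L[ℂ] ℂ :=
  if (j : ℕ) = 0 then -ContinuousLinearMap.proj j
  else ContinuousLinearMap.proj j -
    ContinuousLinearMap.proj ⟨(j : ℕ) - 1, lt_of_le_of_lt (Nat.sub_le _ _) j.isLt⟩

lemma hasFDerivAt_linkForm (t : Fin n → ℂ) (j : Fin n) :
    HasFDerivAt (fun s => linkForm s j) (linkLinear j) t := by
  by_cases h : (j : ℕ) = 0
  · simp only [linkForm, linkLinear, if_pos h]
    exact (hasFDerivAt_apply j t).const_sub 1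
  · simp only [linkForm, linkLinear, if_neg h]
    exact (hasFDerivAt_apply j t).sub (hasFDerivAt_apply _ t)

/-- Only the first link is oriented against `t j - extCoord t j`; the sign disappears in logarithmic
derivatives. -/
lemma linkForm_eq (t : Fin n → ℂ) (j : Fin n) :
    linkForm t j = (if (j : ℕ) = 0 then -1 else 1) * (t j - extCoord t j) := by
  obtain ⟨j, hj⟩ := j
  cases j with
  | zero => simp [linkForm, extCoord]
  | succ j => simp [linkForm, extCoord, Nat.lt_of_succ_lt hj]

lemma linkForm_ne_zero_iff (t : Fin n → ℂ) (j : Fin n) :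
    linkForm t j ≠ 0 ↔ t j - extCoord t j ≠ 0 := by
  rw [linkForm_eq]; split_ifs <;> simp [sub_eq_zero, eq_comm]

lemma linkLinear_single_div (t : Fin n → ℂ) (i j : Fin n) :
    (linkForm t j)⁻¹ * linkLinear j (Pi.single i 1) =
      (if j = i then (t i - extCoord t i)⁻¹ else 0) +
        if (j : ℕ) = i + 1 then (t i - t j)⁻¹ else 0 := by
  rw [linkForm_eq]
  obtain ⟨j, hj⟩ := j
  cases j with
  | zero =>
    by_cases h : (⟨0, hj⟩ : Fin n) = i
    · subst h
      simp only [linkLinear, if_true]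
      simp
      rw [← inv_neg, neg_sub]
    · simp [linkLinear, h]
  | succ j =>
    have hj' : j < n := Nat.lt_of_succ_lt hj
    by_cases h : (⟨j + 1, hj⟩ : Fin n) = i
    · subst h
      simp [linkLinear]
    · by_cases h' : (⟨j, hj'⟩ : Fin n) = i
      · subst h'
        simp [linkLinear, extCoord, hj']
        rw [← inv_neg, neg_sub]
      · have h2 : j ≠ i := fun e => h' (Fin.ext e)
        simp [linkLinear, h, h', h2]

lemma phaseBranch_self_ne_zero (lam : Fin n → ℂ) (κ : ℂ) {t : Fin n → ℂ} (ht : ∀ j, t j ≠ 0)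
    (hl : ∀ j, linkForm t j ≠ 0) : phaseBranch lam κ t t ≠ 0 := by
  refine Finset.prod_ne_zero_iff.2 fun j _ => ?_
  rw [div_self (ht j), div_self (hl j), Complex.one_cpow, Complex.one_cpow]
  simp [Complex.cpow_eq_zero_iff, ht j, hl j]

lemma hasFDerivAt_branch {f : (Fin n → ℂ) → ℂ} {f' : (Fin n → ℂ) →L[ℂ] ℂ} {t : Fin n → ℂ}
    (hf : HasFDerivAt f f' t) (h0 : f t ≠ 0) (a : ℂ) :
    HasFDerivAt (fun s => f t ^ a * (f s / f t) ^ a) ((f t ^ a * (a * (f t)⁻¹)) • f') t := by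
  have h1 : HasFDerivAt (fun s => f s / f t) ((f t)⁻¹ • f') t := by
    simpa [div_eq_mul_inv] using hf.mul_const (f t)⁻¹
  have h2 := ((Complex.hasStrictDerivAt_cpow_const (c := a) (x := f t / f t)
    (by simp [div_self h0])).hasDerivAt.comp_hasFDerivAt t h1).const_mul (f t ^ a)
  refine h2.congr_fderiv ?_
  rw [div_self h0, Complex.one_cpow, mul_one, smul_smul, smul_smul, mul_assoc]

lemma hasFDerivAt_phaseBranch (lam : Fin n → ℂ) (κ : ℂ) {t : Fin n → ℂ} (ht : ∀ j, t j ≠ 0)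
    (hl : ∀ j, linkForm t j ≠ 0) :
    HasFDerivAt (phaseBranch lam κ t) (phaseBranch lam κ t t •
      ∑ j, ((-lam j / κ * (t j)⁻¹) • ContinuousLinearMap.proj (R := ℂ) j +
        (-1 / κ * (linkForm t j)⁻¹) • linkLinear j)) t := by
  have h := HasFDerivAt.finsetProd (u := Finset.univ) (x := t)
    (fun j _ => (hasFDerivAt_branch (hasFDerivAt_apply j t) (ht j) (-lam j / κ)).mul
      (hasFDerivAt_branch (hasFDerivAt_linkForm t j) (hl j) (-1 / κ)))
  refine h.congr_fderiv ?_
  rw [Finset.smul_sum]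
  refine Finset.sum_congr rfl fun j _ => ?_
  rw [phaseBranch, ← Finset.mul_prod_erase _ _ (Finset.mem_univ j)]
  simp only [Pi.mul_apply, div_self (ht _), div_self (hl _), Complex.one_cpow, mul_one]
  ext v
  simp only [smul_apply, add_apply, smul_eq_mul]
  ring

lemma sum_val_eq_succ (f : Fin n → ℂ) (i : Fin n) :
    (∑ j : Fin n, if (j : ℕ) = i + 1 then f j else 0) =
      if h : (i : ℕ) + 1 < n then f ⟨i + 1, h⟩ else 0 := by
  split_ifs with h
  · rw [Finset.sum_eq_single ⟨i + 1, h⟩]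
    · simp
    · intro j _ hj
      exact if_neg fun e => hj (Fin.ext e)
    · simp
  · exact Finset.sum_eq_zero fun j _ => if_neg (by omega)

theorem isCriticalPoint_iff (lam : Fin n → ℂ) {κ : ℂ} (hκ : κ ≠ 0) (t : Fin n → ℂ) :
    IsCriticalPoint lam κ t ↔ (∀ j, t j ≠ 0) ∧ (∀ j, linkForm t j ≠ 0) ∧
      ∀ i, betheEq lam t i = 0 := by
  have key : (∀ j, t j ≠ 0) → (∀ j, linkForm t j ≠ 0) →
      (HasFDerivAt (phaseBranch lam κ t) (0 : (Fin n → ℂ) →L[ℂ] ℂ) t ↔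
        ∀ i, betheEq lam t i = 0) := by
    intro ht hl
    have hd := hasFDerivAt_phaseBranch lam κ ht hl
    have hval : ∀ i, (phaseBranch lam κ t t •
      ∑ j, ((-lam j / κ * (t j)⁻¹) • ContinuousLinearMap.proj (R := ℂ) j +
        (-1 / κ * (linkForm t j)⁻¹) • linkLinear j) : (Fin n → ℂ) →L[ℂ] ℂ) (Pi.single i 1) =
          phaseBranch lam κ t t * ((-1 / κ) * betheEq lam t i) := by
      intro i
      rw [smul_apply, sum_apply, smul_eq_mul, betheEq,
        ← sum_val_eq_succ (fun j => (t i - t j)⁻¹)]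
      congr 1
      simp only [add_apply, smul_apply, smul_eq_mul,
        ContinuousLinearMap.proj_apply, mul_assoc, linkLinear_single_div, Finset.sum_add_distrib,
        ← Finset.mul_sum, Finset.sum_ite_eq', Finset.mem_univ, if_true, Pi.single_apply]
      simp
      ring
    have hP := phaseBranch_self_ne_zero lam κ ht hl
    constructor
    · intro h i
      have := hval i
      rw [hd.unique h, zero_apply] at this
      simpa [hP, hκ] using this.symm
    · intro h
      refine hd.congr_fderiv ?_
      refine ContinuousLinearMap.coe_injective (LinearMap.pi_ext' fun i => LinearMap.ext_ring ?_)
      refine (hval i).trans ?_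
      simp [h i]
  exact ⟨fun h => ⟨h.1, h.2, (key h.1 h.2).1 h.3⟩, fun h => ⟨h.1, h.2.1, (key h.1 h.2.1).2 h.2.2⟩⟩

lemma tailSum_eq (lam : Fin n → ℂ) (i : Fin n) :
    tailSum lam i = lam i + if h : (i : ℕ) + 1 < n then tailSum lam ⟨i + 1, h⟩ + 1 else 0 := by
  have h1 : Finset.Ici i = insert i (Finset.Ioi i) := by ext j; simp [le_iff_eq_or_lt]
  rw [tailSum, h1, Finset.sum_insert (by simp)]
  split_ifs with h
  · have h2 : Finset.Ioi i = Finset.Ici ⟨i + 1, h⟩ := by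
      ext j
      rw [Finset.mem_Ioi, Finset.mem_Ici, Fin.lt_def, Fin.le_def]
      exact Nat.succ_le_iff.symm
    rw [tailSum, h2, show n - ((i : ℕ) + 1) = n - ((i : ℕ) + 1 + 1) + 1 by omega]
    push_cast; ring
  · have h2 : Finset.Ioi i = ∅ := by
      refine Finset.eq_empty_of_forall_notMem fun j hj => ?_
      have := Fin.lt_def.1 (Finset.mem_Ioi.1 hj)
      omega
    rw [h2, show n - ((i : ℕ) + 1) = 0 by omega]
    simp

/-- The relation at `i + 1` turns `1 / (t_i - t_{i+1})` into `(A_{i+1} + 1) / t_i`. Since `A_i = lam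
i + A_{i+1} + 1`, the equation collapses to `A_i / t_i + 1 / (t_i - extCoord t i) = 0`. -/
lemma betheEq_eq_zero_iff_step (lam : Fin n → ℂ)
    {t : Fin n → ℂ} (ht : ∀ j, t j ≠ 0) (hl : ∀ j, linkForm t j ≠ 0) (i : Fin n)
    (hnext : ∀ h : (i : ℕ) + 1 < n, t ⟨i + 1, h⟩ * (tailSum lam ⟨i + 1, h⟩ + 1) =
      tailSum lam ⟨i + 1, h⟩ * t i) :
    betheEq lam t i = 0 ↔ t i * (tailSum lam i + 1) = tailSum lam i * extCoord t i := by
  have hi := (linkForm_ne_zero_iff t i).1 (hl i)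
  have hti := ht i
  have e : betheEq lam t i = tailSum lam i / t i + (t i - extCoord t i)⁻¹ := by
    rw [betheEq, tailSum_eq]
    split_ifs with h
    · have h' := hnext h
      have hj := (linkForm_ne_zero_iff t ⟨i + 1, h⟩).1 (hl _)
      rw [extCoord_succ] at hj
      have hj' : t i - t ⟨i + 1, h⟩ ≠ 0 := sub_ne_zero.2 (sub_ne_zero.1 hj).symm
      have : (t i - t ⟨i + 1, h⟩)⁻¹ = (tailSum lam ⟨i + 1, h⟩ + 1) / t i := by
        rw [inv_eq_one_div, div_eq_div_iff hj' hti]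
        linear_combination h'
      rw [this]; ring
    · ring
  rw [e, ← mul_right_inj' (mul_ne_zero hti hi), mul_zero]
  have : t i * (t i - extCoord t i) * (tailSum lam i / t i + (t i - extCoord t i)⁻¹) =
      tailSum lam i * (t i - extCoord t i) + t i := by
    field_simp
  rw [this]
  constructor <;> intro h <;> linear_combination h

theorem betheEq_iff (lam : Fin n → ℂ) {t : Fin n → ℂ} (ht : ∀ j, t j ≠ 0)
    (hl : ∀ j, linkForm t j ≠ 0) :
    (∀ i, betheEq lam t i = 0) ↔
      ∀ i : Fin n, t i * (tailSum lam i + 1) = tailSum lam i * extCoord t i := by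
  constructor
  · intro h
    -- Descending induction: `d` is the distance to the last letter, whose equation has no right
    -- neighbour.
    have : ∀ d : ℕ, ∀ i : Fin n, (i : ℕ) + d + 1 = n →
        t i * (tailSum lam i + 1) = tailSum lam i * extCoord t i := by
      intro d
      induction d with
      | zero =>
        intro i hi
        exact (betheEq_eq_zero_iff_step lam ht hl i (fun h' => by omega)).1 (h i)
      | succ d ih =>
        intro i hi
        refine (betheEq_eq_zero_iff_step lam ht hl i fun h' => ?_).1 (h i)
        have := ih ⟨i + 1, h'⟩ (by simp; omega)
        rwa [extCoord_succ] at this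
    exact fun i => this (n - 1 - i) i (by omega)
  · intro h i
    refine (betheEq_eq_zero_iff_step lam ht hl i fun h' => ?_).2 (h i)
    have := h ⟨i + 1, h'⟩
    rwa [extCoord_succ] at this

/-- The numbers `A_k / (A_k + 1)`, indexed by natural numbers. -/
def coordRatio (lam : Fin n → ℂ) (k : ℕ) : ℂ :=
  if h : k < n then tailSum lam ⟨k, h⟩ / (tailSum lam ⟨k, h⟩ + 1) else 1

lemma coordRatio_val (lam : Fin n → ℂ) (k : Fin n) :
    coordRatio lam k = tailSum lam k / (tailSum lam k + 1) := by simp [coordRatio]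

lemma extCoord_eq_prod (lam : Fin n → ℂ) {t : Fin n → ℂ}
    (h1 : ∀ k, tailSum lam k + 1 ≠ 0)
    (h : ∀ i : Fin n, t i * (tailSum lam i + 1) = tailSum lam i * extCoord t i) {k : ℕ}
    (hk : k ≤ n) : extCoord t k = ∏ j ∈ Finset.range k, coordRatio lam j := by
  induction k with
  | zero => simp [extCoord]
  | succ k ih =>
    have hk' : k < n := hk
    rw [Finset.prod_range_succ, ← ih hk'.le]
    have h2 := h ⟨k, hk'⟩
    have h3 := coordRatio_val lam ⟨k, hk'⟩
    have h4 := extCoord_succ t ⟨k, hk'⟩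
    simp only at h2 h3 h4
    rw [h3, h4, mul_div_assoc', eq_div_iff (h1 _), h2, mul_comm]

theorem existsUnique_isCriticalPoint (lam : Fin n → ℂ) {κ : ℂ} (hκ : κ ≠ 0)
    (hlam : ∀ k, tailSum lam k ≠ 0 ∧ tailSum lam k + 1 ≠ 0) :
    ∃! t : Fin n → ℂ, IsCriticalPoint lam κ t := by
  have hr : ∀ k : Fin n, coordRatio lam k ≠ 0 := fun k => by
    rw [coordRatio_val]; exact div_ne_zero (hlam k).1 (hlam k).2
  refine ⟨fun k => ∏ j ∈ Finset.range (k + 1), coordRatio lam j, ?_, fun t ht => ?_⟩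
  · have hprod : ∀ k : ℕ, k ≤ n → ∏ j ∈ Finset.range k, coordRatio lam j ≠ 0 := fun k hk =>
      Finset.prod_ne_zero_iff.2 fun j hj => hr ⟨j, (Finset.mem_range.1 hj).trans_le hk⟩
    have hext : ∀ k : ℕ, k ≤ n →
        extCoord (fun k : Fin n => ∏ j ∈ Finset.range (k + 1), coordRatio lam j) k =
          ∏ j ∈ Finset.range k, coordRatio lam j := by
      intro k hk
      cases k with
      | zero => simp [extCoord]
      | succ k => simp [extCoord, Nat.lt_of_succ_le hk]
    have hrec : ∀ i : Fin n, (∏ j ∈ Finset.range (i + 1), coordRatio lam j) * (tailSum lam i + 1) =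
        tailSum lam i * ∏ j ∈ Finset.range i, coordRatio lam j := by
      intro i
      have := (hlam i).2
      rw [Finset.prod_range_succ, coordRatio_val]
      field_simp
    have ht0 : ∀ i : Fin n, ∏ j ∈ Finset.range (i + 1), coordRatio lam j ≠ 0 :=
      fun i => hprod _ i.2
    have hl0 : ∀ j, linkForm (fun k : Fin n => ∏ j ∈ Finset.range (k + 1), coordRatio lam j) j
        ≠ 0 := by
      intro i
      rw [linkForm_ne_zero_iff, hext _ i.2.le]
      -- If two consecutive coordinates agreed, the recursion would force the earlier one to be
      -- zero.
      intro h
      have h2 := hrec i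
      rw [sub_eq_zero] at h
      rw [h] at h2
      exact hprod _ i.2.le (by linear_combination h2)
    refine (isCriticalPoint_iff lam hκ _).2 ⟨ht0, hl0, (betheEq_iff lam ht0 hl0).2 fun i => ?_⟩
    rw [hext _ i.2.le]
    exact hrec i
  · obtain ⟨h1, h2, h3⟩ := (isCriticalPoint_iff lam hκ t).1 ht
    funext k
    rw [← extCoord_succ t k]
    exact extCoord_eq_prod lam (fun k => (hlam k).2) ((betheEq_iff lam h1 h2).1 h3) k.2

end Critical

/-! ### The norm of the Bethe vector -/

section Norm

variable {n : ℕ}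

/-- The difference of consecutive coordinates. -/
def coordStep (t : Fin n → ℂ) (k : ℕ) : ℂ := extCoord t (k + 1) - extCoord t k

lemma coordStep_val (t : Fin n → ℂ) (k : Fin n) : coordStep t k = t k - extCoord t k := by
  rw [coordStep, extCoord_succ]

lemma betheSum_of_not_adjacent (lam t : Fin n → ℂ) {i : Fin n} {I : List (Fin n)}
    (h : ∀ j ∈ I, ¬ Adjacent i j) : betheSum lam t i I = lam i / t i := by
  rw [betheSum, List.sum_eq_zero, add_zero]
  intro x hx
  obtain ⟨j, hj, rfl⟩ := List.mem_map.1 hx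
  exact if_neg (h j hj)

lemma betheSum_tailWord_succ (lam t : Fin n → ℂ) (i : Fin n) :
    betheSum lam t i (tailWord n (i + 1)) =
      lam i / t i + if h : (i : ℕ) + 1 < n then (t i - t ⟨i + 1, h⟩)⁻¹ else 0 := by
  split_ifs with h
  · have h1 := tailWord_eq_cons (⟨i + 1, h⟩ : Fin n)
    simp only at h1
    rw [h1, betheSum_cons, if_pos (show Adjacent i ⟨i + 1, h⟩ from Or.inl rfl), betheSum_of_not_adjacent]
    intro j hj
    rw [mem_tailWord] at hj
    rintro (e | e) <;> omega
  · rw [betheSum_of_not_adjacent, add_zero]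
    intro j hj
    rw [mem_tailWord] at hj
    omega

/-- The neighbour below `i` is missing from the word, so the sum is minus the corresponding term of
the Bethe equation. -/
lemma betheSum_tailWord_succ_of_betheEq {lam t : Fin n → ℂ} {i : Fin n}
    (h : betheEq lam t i = 0) :
    betheSum lam t i (tailWord n (i + 1)) = -(coordStep t i)⁻¹ := by
  rw [betheSum_tailWord_succ, coordStep_val]
  rw [betheEq] at h
  linear_combination h

/-- All neighbours of `i` now occur, so the sum is the full Bethe equation; letters further below
contribute nothing. -/
lemma betheSum_tailWord_of_lt {lam t : Fin n → ℂ} {i : Fin n} (h : betheEq lam t i = 0) {k : ℕ}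
    (hk : k < i) : betheSum lam t i (tailWord n k) = 0 := by
  obtain ⟨d, hd⟩ : ∃ d, (i : ℕ) = k + 1 + d := ⟨i - (k + 1), by omega⟩
  induction d generalizing k with
  | zero =>
    have hkn : k < n := by omega
    have h1 := tailWord_eq_cons (⟨k, hkn⟩ : Fin n)
    simp only at h1
    have h2 := extCoord_succ t ⟨k, hkn⟩
    simp only at h2
    rw [h1, betheSum_cons, show k + 1 = (i : ℕ) by omega, tailWord_eq_cons, betheSum_cons,
      betheSum_tailWord_succ_of_betheEq h, if_neg (by rintro (e | e) <;> omega),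
      if_pos (show Adjacent i ⟨k, hkn⟩ from Or.inr hd.symm), coordStep_val, hd, add_zero, h2]
    ring
  | succ d ih =>
    have hkn : k < n := by omega
    have h1 := tailWord_eq_cons (⟨k, hkn⟩ : Fin n)
    simp only at h1
    rw [h1, betheSum_cons, ih (by omega) (by omega), if_neg (by rintro (e | e) <;> simp at e <;> omega),
      add_zero]

variable {lam t : Fin n → ℂ}

lemma chevE_wordSum_tailWord_self (ht : ∀ j, t j ≠ 0) (hinj : Function.Injective t)
    (h : ∀ i, betheEq lam t i = 0) (i : Fin n) :
    ⁅chevE i, wordSum t (vermaVec lam) (tailWord n i)⁆ =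
      -(coordStep t i)⁻¹ • wordSum t (vermaVec lam) (tailWord n (i + 1)) := by
  have hnd := nodup_tailWord (n := n) i
  rw [tailWord_eq_cons] at hnd ⊢
  rw [chevE_wordSum_cons (chevE_vermaVec lam i) (chevH_vermaVec lam i) ht hinj hnd,
    betheSum_tailWord_succ_of_betheEq (h i)]

lemma chevE_wordSum_tailWord_of_ne (ht : ∀ j, t j ≠ 0) (hinj : Function.Injective t)
    (h : ∀ i, betheEq lam t i = 0) (i : Fin n) {k : ℕ} (hk : (i : ℕ) ≠ k) :
    ⁅chevE i, wordSum t (vermaVec lam) (tailWord n k)⁆ = 0 := by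
  rcases lt_or_gt_of_ne hk with hk | hk
  · exact chevE_wordSum_of_notMem (chevE_vermaVec lam i) (by rw [mem_tailWord]; omega)
  · have hp : (tailWord n k).Perm (i :: (tailWord n k).erase i) :=
      List.perm_cons_erase (mem_tailWord.2 hk.le)
    have hs := betheSum_tailWord_of_lt (h i) hk
    rw [betheSum_perm _ _ _ hp, betheSum_cons, if_neg (by rintro (e | e) <;> omega), add_zero] at hs
    rw [wordSum_perm t _ hp, chevE_wordSum_cons (chevE_vermaVec lam i) (chevH_vermaVec lam i) ht
      hinj (hp.nodup_iff.1 (nodup_tailWord k)), hs, zero_smul]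

/-- Moving the first letter of `I` across the form as an `e_i` gives zero unless it is the smallest
letter `k`, and then replaces `k` by `k + 1`. Only the increasing word survives. -/
lemma shapovalovForm_fWord_wordSum (ht : ∀ j, t j ≠ 0) (hinj : Function.Injective t)
    (h : ∀ i, betheEq lam t i = 0) {k : ℕ} (hk : k ≤ n) {I : List (Fin n)}
    (hI : I.Perm (tailWord n k)) :
    shapovalovForm n (vermaVec lam) (fWord I (vermaVec lam))
        (wordSum t (vermaVec lam) (tailWord n k)) =
      if I = tailWord n k then ∏ j ∈ Finset.Ico k n, -(coordStep t j)⁻¹ else 0 := by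
  have hB := isShapovalovForm_verma lam
  induction I generalizing k with
  | nil =>
    have hlen := hI.length_eq
    rw [length_tailWord, List.length_nil] at hlen
    obtain rfl : k = n := by omega
    rw [tailWord_self, if_pos rfl, Finset.Ico_self, Finset.prod_empty]
    simpa [wordSum, chainFun, fWord] using hB.normalized
  | cons i I ih =>
    rw [fWord_cons, hB.symm, ← hB.contravariant, hB.symm]
    by_cases hik : (i : ℕ) = k
    · subst hik
      rw [chevE_wordSum_tailWord_self ht hinj h, map_smul]
      rw [tailWord_eq_cons i] at hI ⊢
      rw [ih (Nat.succ_le_of_lt i.2) ((List.perm_cons i).1 hI), smul_eq_mul, mul_ite, mul_zero,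
        Finset.prod_eq_prod_Ico_succ_bot i.2]
      simp only [List.cons_inj_right]
    · rw [chevE_wordSum_tailWord_of_ne ht hinj h i hik, map_zero, if_neg]
      intro e
      have hkn : k < n := by
        by_contra hkn
        have := congrArg List.length e
        rw [length_tailWord, List.length_cons] at this
        omega
      have h1 := tailWord_eq_cons (⟨k, hkn⟩ : Fin n)
      simp only at h1
      rw [h1, List.cons.injEq] at e
      exact hik (congrArg Fin.val e.1)

lemma shapovalovForm_wordSum_self (ht : ∀ j, t j ≠ 0) (hinj : Function.Injective t)
    (h : ∀ i, betheEq lam t i = 0) {k : ℕ} (hk : k ≤ n) :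
    shapovalovForm n (vermaVec lam) (wordSum t (vermaVec lam) (tailWord n k))
        (wordSum t (vermaVec lam) (tailWord n k)) =
      chainFun t 0 (tailWord n k) * ∏ j ∈ Finset.Ico k n, -(coordStep t j)⁻¹ := by
  nth_rw 1 [wordSum_eq_sum t _ (nodup_tailWord k)]
  rw [map_sum, LinearMap.sum_apply, Finset.sum_eq_single (tailWord n k)]
  · rw [map_smul, LinearMap.smul_apply, shapovalovForm_fWord_wordSum ht hinj h hk (List.Perm.refl _),
      if_pos rfl, smul_eq_mul]
  · intro I hI hne
    rw [List.mem_toFinset, List.mem_permutations'] at hI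
    rw [map_smul, LinearMap.smul_apply, shapovalovForm_fWord_wordSum ht hinj h hk hI, if_neg hne,
      smul_zero]
  · intro hI
    simp at hI

lemma chainFun_headWord (t : Fin n → ℂ) {k : ℕ} (hk : k ≤ n) :
    chainFun t 1 (headWord n k) = ∏ j ∈ Finset.range k, (coordStep t j)⁻¹ := by
  induction k with
  | zero => simp [headWord_zero, chainFun]
  | succ k ih =>
    have h1 := headWord_succ (⟨k, hk⟩ : Fin n)
    simp only at h1
    rw [Finset.prod_range_succ, ← ih (by omega), h1, mul_comm]
    have h2 := coordStep_val t ⟨k, hk⟩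
    simp only at h2
    rw [h2]
    cases k with
    | zero => simp [headWord_zero, chainFun, extCoord]
    | succ k =>
      have h3 := headWord_succ (⟨k, by omega⟩ : Fin n)
      have h4 := extCoord_succ t ⟨k, by omega⟩
      simp only at h3 h4
      rw [h3, h4, chainFun]

/-- The chain of the increasing word has the links after `k` and a last factor with the `n`-th
coordinate; the two extra factors remove the latter and supply the missing link at `k`. -/
lemma chainFun_tailWord (ht : ∀ j, t j ≠ 0) {k : ℕ} (hk : k < n) :
    chainFun t 0 (tailWord n k) * extCoord t n * -(coordStep t k)⁻¹ =
      ∏ j ∈ Finset.Ico k n, -(coordStep t j)⁻¹ := by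
  obtain ⟨d, hd⟩ : ∃ d, k + 1 + d = n := ⟨n - (k + 1), by omega⟩
  induction d generalizing k with
  | zero =>
    obtain rfl : n = k + 1 := by omega
    have h1 := tailWord_eq_cons (⟨k, hk⟩ : Fin (k + 1))
    have h2 := extCoord_succ t ⟨k, hk⟩
    simp only at h1 h2
    rw [h1, tailWord_self, Nat.Ico_succ_singleton, Finset.prod_singleton, h2, chainFun, sub_zero,
      inv_mul_cancel₀ (ht _), one_mul]
  | succ d ih =>
    have hk1 : k + 1 < n := by omega
    have h1 := tailWord_eq_cons (⟨k, hk⟩ : Fin n)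
    have h3 := tailWord_eq_cons (⟨k + 1, hk1⟩ : Fin n)
    have h2 := coordStep_val t ⟨k + 1, hk1⟩
    have h4 := extCoord_succ t ⟨k, hk⟩
    have h5 := ih hk1 (by omega)
    simp only at h1 h2 h3 h4
    rw [Finset.prod_eq_prod_Ico_succ_bot hk, ← h5, h2, h4, h1, h3, chainFun, ← h3, ← neg_sub (t ⟨k + 1, hk1⟩), inv_neg]
    ring

theorem tensorForm_betheVector_eq (ht : ∀ j, t j ≠ 0) (hl : ∀ j, linkForm t j ≠ 0)
    (hinj : Function.Injective t) (h : ∀ i, betheEq lam t i = 0) :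
    tensorForm lam (betheVector lam t) (betheVector lam t) =
        (∏ j ∈ Finset.range n, (coordStep t j)⁻¹) ^ 2 / extCoord t n ∧
      (0 < n → shapovalovForm n (vermaVec lam) (betheTop lam t) (betheTop lam t) =
        (∏ j ∈ Finset.range n, (coordStep t j)⁻¹) ^ 2 / extCoord t n * -coordStep t 0) := by
  have hT : extCoord t n ≠ 0 := by
    cases n with
    | zero => simp [extCoord]
    | succ n => exact (extCoord_succ t (Fin.last n)).symm ▸ ht _
  have hstep : ∀ k, k < n → coordStep t k ≠ 0 := fun k hk => by
    have := coordStep_val t ⟨k, hk⟩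
    simp only at this
    rw [this]
    exact (linkForm_ne_zero_iff t ⟨k, hk⟩).1 (hl _)
  have key : ∀ k, k < n → chainFun t 1 (headWord n k) ^ 2 *
      shapovalovForm n (vermaVec lam) (wordSum t (vermaVec lam) (tailWord n k))
        (wordSum t (vermaVec lam) (tailWord n k)) =
      (∏ j ∈ Finset.range n, (coordStep t j)⁻¹) ^ 2 / extCoord t n * -coordStep t k := by
    intro k hk
    rw [shapovalovForm_wordSum_self ht hinj h hk.le, chainFun_headWord t hk.le,
      ← Finset.prod_range_mul_prod_Ico _ hk.le]
    have h1 := chainFun_tailWord ht hk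
    have h2 : chainFun t 0 (tailWord n k) =
        (∏ j ∈ Finset.Ico k n, -(coordStep t j)⁻¹) * -coordStep t k / extCoord t n := by
      rw [← h1]
      have := hstep k hk
      field_simp
    have h3 : (∏ j ∈ Finset.Ico k n, -(coordStep t j)⁻¹) ^ 2 =
        (∏ j ∈ Finset.Ico k n, (coordStep t j)⁻¹) ^ 2 := by
      rw [← Finset.prod_pow, ← Finset.prod_pow]
      exact Finset.prod_congr rfl fun j _ => neg_sq _
    rw [h2, mul_pow, ← h3]
    ring
  constructor
  · rw [tensorForm_betheVector, Fin.sum_univ_castSucc]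
    simp only [Fin.val_castSucc, Fin.val_last]
    rw [shapovalovForm_wordSum_self ht hinj h le_rfl, chainFun_headWord t le_rfl, tailWord_self,
      -- The steps telescope to `1 - extCoord t n`, and the term for `k = n` supplies the remaining
      -- `extCoord t n`.
      Finset.sum_congr rfl fun (k : Fin n) _ => key k k.2, ← Finset.mul_sum,
      Fin.sum_univ_eq_sum_range (fun k => -coordStep t k), Finset.sum_neg_distrib]
    simp only [coordStep]
    rw [Finset.sum_range_sub]
    simp only [chainFun, Finset.Ico_self, Finset.prod_empty, extCoord_zero]
    field_simp
    ring
  · intro hn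
    have := key 0 hn
    rwa [headWord_zero, chainFun, one_pow, one_mul, ← betheTop_eq] at this

lemma prod_prod_range {M : Type*} [CommMonoid M] (r : ℕ → M) (n : ℕ) :
    ∏ j ∈ Finset.range n, ∏ i ∈ Finset.range j, r i = ∏ i ∈ Finset.range n, r i ^ (n - (i + 1)) := by
  induction n with
  | zero => simp
  | succ n ih =>
    rw [Finset.prod_range_succ, ih, ← Finset.prod_mul_distrib, Finset.prod_range_succ]
    simp only [Nat.sub_self, pow_zero, mul_one]
    refine Finset.prod_congr rfl fun i hi => ?_
    rw [← pow_succ]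
    congr 1
    have := Finset.mem_range.1 hi
    omega

/-- The recursion gives `-coordStep t k = extCoord t k / (A_k + 1)`. The ratio `A_k / (A_k + 1)`
enters each later coordinate, hence with exponent `-2(n-k-1)` from the squared steps and `-1` from
the division by `extCoord t n`. -/
lemma prod_coordStep_eq (hlam : ∀ k, tailSum lam k ≠ 0 ∧ tailSum lam k + 1 ≠ 0)
    (h : ∀ i : Fin n, t i * (tailSum lam i + 1) = tailSum lam i * extCoord t i) :
    (∏ j ∈ Finset.range n, (coordStep t j)⁻¹) ^ 2 / extCoord t n =
      ∏ k : Fin n, (tailSum lam k + 1) ^ (2 * (n - ((k : ℕ) + 1)) + 3) /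
          tailSum lam k ^ (2 * (n - ((k : ℕ) + 1)) + 1) := by
  have hs : ∀ k : Fin n, (coordStep t k)⁻¹ =
      -(tailSum lam k + 1) * (∏ i ∈ Finset.range k, coordRatio lam i)⁻¹ := by
    intro k
    rw [← extCoord_eq_prod lam (fun k => (hlam k).2) h k.2.le, coordStep_val,
      ← neg_inj, neg_mul, neg_neg, ← inv_neg, ← div_eq_mul_inv, neg_sub]
    have h2 := (hlam k).2
    have : extCoord t k - t k = extCoord t k / (tailSum lam k + 1) := by
      rw [eq_div_iff h2]
      linear_combination -(h k)
    rw [this, inv_div]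
  rw [← Fin.prod_univ_eq_prod_range, Finset.prod_congr rfl fun k _ => hs k,
    Finset.prod_mul_distrib, extCoord_eq_prod lam (fun k => (hlam k).2) h le_rfl,
    Finset.prod_inv_distrib,
    Fin.prod_univ_eq_prod_range (fun k => ∏ i ∈ Finset.range k, coordRatio lam i), prod_prod_range,
    ← Fin.prod_univ_eq_prod_range, ← Fin.prod_univ_eq_prod_range, ← Finset.prod_inv_distrib,
    ← Finset.prod_mul_distrib, ← Finset.prod_pow, ← Finset.prod_div_distrib]
  refine Finset.prod_congr rfl fun k _ => ?_
  rw [coordRatio_val]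
  obtain ⟨h1, h2⟩ := hlam k
  generalize n - ((k : ℕ) + 1) = m
  rw [div_pow, inv_div, eq_div_iff (pow_ne_zero _ h1)]
  field_simp
  ring

end Norm

end BetheNorm

end

theorem mainTheorem3 (n : ℕ) (hn : 0 < n) (lam : Fin n → ℂ) (κ : ℂ) (hκ : κ ≠ 0)
    (hlam : ∀ k, BetheNorm.tailSum lam k ≠ 0 ∧ BetheNorm.tailSum lam k + 1 ≠ 0) :
    (∃! t : Fin n → ℂ, BetheNorm.IsCriticalPoint lam κ t) ∧
    ∀ t : Fin n → ℂ, BetheNorm.IsCriticalPoint lam κ t → Function.Injective t →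
      BetheNorm.tensorForm lam (BetheNorm.betheVector lam t) (BetheNorm.betheVector lam t) =
        ∏ k : Fin n, (BetheNorm.tailSum lam k + 1) ^ (2 * (n - ((k : ℕ) + 1)) + 3) /
          BetheNorm.tailSum lam k ^ (2 * (n - ((k : ℕ) + 1)) + 1) ∧
      BetheNorm.shapovalovForm n (BetheNorm.vermaVec lam)
          (BetheNorm.betheTop lam t) (BetheNorm.betheTop lam t) =
        BetheNorm.tensorForm lam (BetheNorm.betheVector lam t) (BetheNorm.betheVector lam t) /
          (∑ i, lam i + n) := by
  refine ⟨BetheNorm.existsUnique_isCriticalPoint lam hκ hlam, fun t hcrit hinj => ?_⟩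
  obtain ⟨ht, hl, hb⟩ := (BetheNorm.isCriticalPoint_iff lam hκ t).1 hcrit
  have hrec := (BetheNorm.betheEq_iff lam ht hl).1 hb
  obtain ⟨hX, hx⟩ := BetheNorm.tensorForm_betheVector_eq ht hl hinj hb
  refine ⟨hX.trans (BetheNorm.prod_coordStep_eq hlam hrec), ?_⟩
  rw [hx hn, hX, div_eq_mul_inv _ (_ + _)]
  congr 1
  -- The first recursion step reads `(1 - t_1)(A + 1) = 1`, with `A` the full tail sum, so
  -- `-coordStep t 0` is the inverse of the denominator.
  have h0 := hrec ⟨0, hn⟩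
  have hA : BetheNorm.tailSum lam ⟨0, hn⟩ + 1 = ∑ i, lam i + n := by
    have : Finset.Ici (⟨0, hn⟩ : Fin n) = Finset.univ := by
      ext j; simp [Fin.le_def]
    rw [BetheNorm.tailSum, this]
    simp only [Nat.zero_add]
    rw [Nat.cast_sub hn]
    push_cast; ring
  rw [← hA]
  refine eq_inv_of_mul_eq_one_left ?_
  have h2 := BetheNorm.coordStep_val t ⟨0, hn⟩
  simp only [BetheNorm.extCoord_zero] at h0 h2
  rw [h2]
  linear_combination -h0
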